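/- All schemes are over $\mathbb C$. A \emph{rational angle} is a nodal curve $C=C_1\cup_p C_2$ whose components $C_1,C_2\cong\mathbb P^1$ meet only at the node $p$: in affine coordinates $x,y$ on $C_1,C_2$ centred at $p$, the curve $C$ is the union of the open sets $U=\operatorname{Spec}\mathbb C[x,y]/(xy)$ and $V=C\setminus\{p\}=\operatorname{Spec}\mathbb C[x^{-1}]\sqcup\operatorname{Spec}\mathbb C[y^{-1}]$, with $U\cap V=\operatorname{Spec}\mathbb C[x,x^{-1}]\sqcup\operatorname{Spec}\mathbb C[y,y^{-1}]$. Let $\mathcal O(a,b)$ be the line bundle on $C$ of degree $a$ on $C_1$ and $b$ on $C_2$, and write $E(a,b)=E\otimes\mathcal O(a,b)$, $E(p)=E\otimes k(p)$, and $mL$ for the direct sum of $m\ge 0$ copies of $L$. A vector bundle $F$ on $\mathbb P^1$ is \emph{almost balanced} if $F\cong r\,\mathcal O(k)\oplus s\,\mathcal O(k-1)$ for some $k\in\mathbb Z$ and $r,s\ge 0$. If moreover $k$ is chosen with $r>0$ (unless $F=0$), its positive subsheaf is $F_+=r\,\mathcal O(k)\subseteq F$, which is uniquely determined. A vector bundle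 $E$ on a rational angle is \emph{almost balanced} if for some $k,\ell\in\mathbb Z$ and some non-negative multiplicities $$E\cong r\,\mathcal O(k,\ell)\oplus s_1\mathcal O(k,\ell-1)\oplus s_2\mathcal O(k-1,\ell)\quad\text{or}\quad E\cong r_1\mathcal O(k+1,\ell)\oplus r_2\mathcal O(k,\ell+1)\oplus s\,\mathcal O(k,\ell).$$ Proposition 5.3. For a vector bundle $E$ (locally free sheaf of finite rank) on a rational angle $C=C_1\cup_pC_2$ the following are equivalent: (i) $E$ is almost balanced; (ii) the bundles $E_i=E|_{C_i}$, $i=1,2$, are almost balanced, and the positive subspaces $(E_1)_+(p),(E_2)_+(p)\subseteq E(p)$ are in general position, that is, their intersection has dimension $\max(0,\dim (E_1)_+(p)+\dim (E_2)_+(p)-\dim E(p))$; (iii) for some $k,\ell\in\mathbb Z$ the twist $G=E(-k,-\ell)$ satisfies either $$H^1(C,G)=H^0(C,G(-1,0))=H^0(C,G(0,-1))=0$$ or $$H^0(C,G)=H^1(C,G(1,0))=H^1(C,G(0,1))=0.$$ -/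

import Mathlib

open AlgebraicGeometry CategoryTheory TensorProduct Polynomial LaurentPolynomial

noncomputable section

/-! ### Base change of modules along a ring homomorphism -/

namespace RatAngle

/-- The base change `A' ⊗_A M` of an `A`-module along a ring homomorphism `φ : A → A'`. -/
def BaseChange {A A' : Type} [CommRing A] [CommRing A'] (φ : A →+* A')
    (M : Type) [AddCommGroup M] [Module A M] : Type :=
  letI := φ.toAlgebra
  A' ⊗[A] M

namespace BaseChange

variable {A A' : Type} [CommRing A] [CommRing A'] (φ : A →+* A')
  (M : Type) [AddCommGroup M] [Module A M]

instance : AddCommGroup (BaseChange φ M) :=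
  letI := φ.toAlgebra
  (inferInstance : AddCommGroup (A' ⊗[A] M))

instance : Module A' (BaseChange φ M) :=
  letI := φ.toAlgebra
  (inferInstance : Module A' (A' ⊗[A] M))

variable {M}

/-- The pure tensor `a ⊗ m`. -/
def tmul (a : A') (m : M) : BaseChange φ M :=
  letI := φ.toAlgebra
  a ⊗ₜ[A] m

theorem tmul_add (a : A') (m n : M) : tmul φ a (m + n) = tmul φ a m + tmul φ a n := by
  let := φ.toAlgebra
  exact TensorProduct.tmul_add a m n

theorem tmul_smul (a : A') (r : A) (m : M) : tmul φ a (r • m) = tmul φ (φ r * a) m := by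
  let := φ.toAlgebra
  exact (TensorProduct.smul_tmul r a m).symm

variable (M) in
/-- The canonical map `M → A' ⊗_A M`, `m ↦ 1 ⊗ m`. -/
def mk : M →ₛₗ[φ] BaseChange φ M where
  toFun := tmul φ 1
  map_add' := tmul_add φ 1
  map_smul' := fun r m => tmul_smul φ 1 r m

theorem smul_tmul (b a : A') (m : M) : b • tmul φ a m = tmul φ (b * a) m := rfl

/-- An additive map `f` out of `M` that is semilinear along `ψ ∘ φ` extends uniquely to a map
out of `A' ⊗_A M` that is semilinear along `ψ`, namely `a ⊗ m ↦ ψ a • f m`. -/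
def lift {S : Type} [CommRing S] (ψ : A' →+* S) {Q : Type} [AddCommGroup Q] [Module S Q]
    (f : M →+ Q) (hf : ∀ (a : A) (m : M), f (a • m) = ψ (φ a) • f m) :
    BaseChange φ M →ₛₗ[ψ] Q :=
  letI := φ.toAlgebra
  letI F : A' ⊗[A] M →+ Q :=
    TensorProduct.liftAddHom
      (AddMonoidHom.mk' (fun a : A' => (DistribSMul.toAddMonoidHom Q (ψ a)).comp f)
        (fun a b => by ext m; simp [add_smul]))
      (fun r a m => by
        change ψ (φ r * a) • f m = ψ a • f (r • m)
        rw [hf, map_mul, mul_comm, mul_smul])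
  haveI hF : ∀ (b : A') (x : A' ⊗[A] M), F (b • x) = ψ b • F x := fun b x => by
    induction x using TensorProduct.induction_on with
    | zero => simp
    | tmul a m =>
      change ψ (b * a) • f m = ψ b • ψ a • f m
      rw [map_mul, mul_smul]
    | add x y hx hy => rw [smul_add, map_add, map_add, hx, hy, smul_add]
  { toFun := F
    map_add' := F.map_add
    map_smul' := hF }

theorem lift_tmul {S : Type} [CommRing S] (ψ : A' →+* S) {Q : Type} [AddCommGroup Q]
    [Module S Q] (f : M →+ Q) (hf : ∀ (a : A) (m : M), f (a • m) = ψ (φ a) • f m)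
    (a : A') (m : M) : lift φ ψ f hf (tmul φ a m) = ψ a • f m := rfl

/-- For a commutative square of rings `r' ∘ φ = ψ ∘ r`, a map `f : M → P` semilinear along `r`
induces `A' ⊗_A M → R' ⊗_R P`, `a ⊗ m ↦ r' a ⊗ f m`, semilinear along `r'`. -/
def map {R R' : Type} [CommRing R] [CommRing R'] (ψ : R →+* R') {r : A →+* R} (r' : A' →+* R')
    (h : r'.comp φ = ψ.comp r) {P : Type} [AddCommGroup P] [Module R P] (f : M →ₛₗ[r] P) :
    BaseChange φ M →ₛₗ[r'] BaseChange ψ P :=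
  lift φ r' (AddMonoidHom.mk' (fun m => tmul ψ 1 (f m))
      (fun m n => by rw [map_add, tmul_add]))
    (fun a m => by
      change tmul ψ 1 (f (a • m)) = r' (φ a) • tmul ψ 1 (f m)
      rw [LinearMap.map_smulₛₗ, tmul_smul, smul_tmul]
      exact congrArg (fun z => tmul ψ (z * 1) (f m)) (RingHom.congr_fun h a).symm)

end BaseChange

/-! ### Sheaves of modules on a union of two affine charts

Throughout, `rA : A → R` and `rB : B → R` are the restriction maps of the structure sheaf of a
scheme `X = U ∪ V` with `U = Spec A`, `V = Spec B` and `U ∩ V = Spec R`. -/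

/-- The sections of an `𝒪_X`-module over `U`, `V` and `U ∩ V`, with the restriction maps. -/
structure ChartModule {A B R : Type} [CommRing A] [CommRing B] [CommRing R]
    (rA : A →+* R) (rB : B →+* R) where
  onU : Type
  onV : Type
  onUV : Type
  [addU : AddCommGroup onU]
  [addV : AddCommGroup onV]
  [addUV : AddCommGroup onUV]
  [modU : Module A onU]
  [modV : Module B onV]
  [modUV : Module R onUV]
  resU : onU →ₛₗ[rA] onUV
  resV : onV →ₛₗ[rB] onUV

attribute [instance] ChartModule.addU ChartModule.addV ChartModule.addUV
  ChartModule.modU ChartModule.modV ChartModule.modUV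

namespace ChartModule

variable {A B R : Type} [CommRing A] [CommRing B] [CommRing R] {rA : A →+* R} {rB : B →+* R}

/-- Morphisms of sheaves of modules. -/
structure Hom (E : ChartModule rA rB) (F : ChartModule rA rB) where
  onU : E.onU →ₗ[A] F.onU
  onV : E.onV →ₗ[B] F.onV
  onUV : E.onUV →ₗ[R] F.onUV
  comm_U : ∀ m, onUV (E.resU m) = F.resU (onU m)
  comm_V : ∀ m, onUV (E.resV m) = F.resV (onV m)

/-- A morphism is an isomorphism if it is bijective on sections. -/
def Hom.IsIso {E : ChartModule rA rB} {F : ChartModule rA rB} (h : Hom E F) : Prop :=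
  Function.Bijective h.onU ∧ Function.Bijective h.onV ∧ Function.Bijective h.onUV

/-- Two sheaves of modules are isomorphic. -/
def Isomorphic (E : ChartModule rA rB) (F : ChartModule rA rB) : Prop :=
  ∃ h : Hom E F, h.IsIso

/-- The direct sum `E ⊕ F`. -/
def sum (E : ChartModule rA rB) (F : ChartModule rA rB) :
    ChartModule rA rB where
  onU := E.onU × F.onU
  onV := E.onV × F.onV
  onUV := E.onUV × F.onUV
  resU :=
    { toFun := fun m => (E.resU m.1, F.resU m.2)
      map_add' := fun m n => by simp
      map_smul' := fun a m => by simp [LinearMap.map_smulₛₗ] }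
  resV :=
    { toFun := fun m => (E.resV m.1, F.resV m.2)
      map_add' := fun m n => by simp
      map_smul' := fun a m => by simp [LinearMap.map_smulₛₗ] }

/-- The inclusion of the first summand. -/
def inl (E : ChartModule rA rB) (F : ChartModule rA rB) : Hom E (E.sum F) where
  onU := LinearMap.inl A E.onU F.onU
  onV := LinearMap.inl B E.onV F.onV
  onUV := LinearMap.inl R E.onUV F.onUV
  comm_U := fun _ => Prod.ext rfl (map_zero F.resU).symm
  comm_V := fun _ => Prod.ext rfl (map_zero F.resV).symm

/-- The direct sum `n E` of `n` copies of `E`. -/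
def copies (n : ℕ) (E : ChartModule rA rB) : ChartModule rA rB where
  onU := Fin n → E.onU
  onV := Fin n → E.onV
  onUV := Fin n → E.onUV
  resU :=
    { toFun := fun m i => E.resU (m i)
      map_add' := fun m n => by ext; simp
      map_smul' := fun a m => by ext; simp [LinearMap.map_smulₛₗ] }
  resV :=
    { toFun := fun m i => E.resV (m i)
      map_add' := fun m n => by ext; simp
      map_smul' := fun a m => by ext; simp [LinearMap.map_smulₛₗ] }

/-- Composition of morphisms. -/
def Hom.comp {E F G : ChartModule rA rB} (g : Hom F G) (f : Hom E F) : Hom E G where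
  onU := g.onU ∘ₗ f.onU
  onV := g.onV ∘ₗ f.onV
  onUV := g.onUV ∘ₗ f.onUV
  comm_U := fun m => by simp [f.comm_U, g.comm_U]
  comm_V := fun m => by simp [f.comm_V, g.comm_V]

/-- The tensor product `E ⊗ F`. -/
def tensor (E : ChartModule rA rB) (F : ChartModule rA rB) :
    ChartModule rA rB where
  onU := E.onU ⊗[A] F.onU
  onV := E.onV ⊗[B] F.onV
  onUV := E.onUV ⊗[R] F.onUV
  resU := TensorProduct.map E.resU F.resU
  resV := TensorProduct.map E.resV F.resV

variable (rA rB) in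
/-- The line bundle that is free with a generator `e_U` over `U` and a generator `e_V` over `V`,
where `e_V = c e_U` on `U ∩ V`. -/
def glueUnit (c : Rˣ) : ChartModule rA rB where
  onU := A
  onV := B
  onUV := R
  resU :=
    { toFun := rA
      map_add' := map_add rA
      map_smul' := map_mul rA }
  resV :=
    { toFun := fun b => c * rB b
      map_add' := fun a b => by rw [map_add, mul_add]
      map_smul' := fun a b => by simp only [smul_eq_mul, map_mul]; ring }

/-- The pullback of `E` to a scheme `X' = U' ∪ V'` along a morphism that maps `U' = Spec A'`,
`V' = Spec B'`, `U' ∩ V' = Spec R'` to `U`, `V`, `U ∩ V`. -/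
def pullback {A' B' R' : Type} [CommRing A'] [CommRing B'] [CommRing R']
    (E : ChartModule rA rB) (rA' : A' →+* R') (rB' : B' →+* R')
    (α : A →+* A') (β : B →+* B') (ρ : R →+* R')
    (hα : rA'.comp α = ρ.comp rA) (hβ : rB'.comp β = ρ.comp rB) :
    ChartModule rA' rB' where
  onU := BaseChange α E.onU
  onV := BaseChange β E.onV
  onUV := BaseChange ρ E.onUV
  resU := BaseChange.map α ρ rA' hα E.resU
  resV := BaseChange.map β ρ rB' hβ E.resV

/-- The differential `(m, n) ↦ m|_{U ∩ V} - n|_{U ∩ V}` of the Čech complex of `{U, V}`. -/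
def cechD (E : ChartModule rA rB) : E.onU × E.onV →+ E.onUV :=
  AddMonoidHom.mk' (fun m => E.resU m.1 - E.resV m.2) (fun m n => by
    simp only [Prod.fst_add, Prod.snd_add, map_add]; abel)

/-- `H⁰(X, E)`. -/
abbrev H0 (E : ChartModule rA rB) : Type := E.cechD.ker

/-- `H¹(X, E)`. -/
abbrev H1 (E : ChartModule rA rB) : Type := E.onUV ⧸ E.cechD.range

/-- The fibre `E(p) = k(p) ⊗ E` at a closed point `p` of `U` with residue field `ℂ`, given by the
evaluation homomorphism `ev : A → ℂ`. -/
abbrev fibre (E : ChartModule rA rB) (ev : A →+* ℂ) : Type := BaseChange ev E.onU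

/-- The map on fibres that a morphism induces. -/
def Hom.fibre {E F : ChartModule rA rB} (h : Hom E F) (ev : A →+* ℂ) :
    E.fibre ev →ₗ[ℂ] F.fibre ev :=
  BaseChange.map ev ev (RingHom.id ℂ) (r := RingHom.id A) (by ext; rfl) h.onU

end ChartModule

/-! ### The projective line -/

/-- `ℙ¹` is covered by `U = Spec ℂ[x]` and `V = Spec ℂ[u]`, with `U ∩ V = Spec ℂ[x, x⁻¹]` and
`u = x⁻¹`. This is the restriction from `U`. -/
def lineResU : ℂ[X] →+* ℂ[T;T⁻¹] := Polynomial.toLaurent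

/-- The restriction from `V`, which sends the coordinate `u` to `x⁻¹`. -/
def lineResV : ℂ[X] →+* ℂ[T;T⁻¹] :=
  (LaurentPolynomial.invert (R := ℂ) : ℂ[T;T⁻¹] →+* ℂ[T;T⁻¹]).comp Polynomial.toLaurent

/-- The unit `x ^ k` of `ℂ[x, x⁻¹]`. -/
def unitT (k : ℤ) : ℂ[T;T⁻¹]ˣ where
  val := T k
  inv := T (-k)
  val_inv := by rw [← T_add]; simp
  inv_val := by rw [← T_add]; simp

/-- Sheaves of modules on `ℙ¹`. -/
abbrev LineModule := ChartModule lineResU lineResV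

/-- The line bundle `𝒪(k)` of degree `k` on `ℙ¹`; a global section is a pair of polynomials
`f(x)`, `g(u)` with `f(x) = x ^ k * g(x⁻¹)`. -/
def lineO (k : ℤ) : LineModule := ChartModule.glueUnit lineResU lineResV (unitT k)

/-- The point `x = 0` of `ℙ¹`. -/
def lineEv : ℂ[X] →+* ℂ := Polynomial.evalRingHom 0

namespace LineModule

/-- `F ≅ r 𝒪(k) ⊕ s 𝒪(k-1)` for some `k`, `r`, `s`. -/
def AlmostBalanced (F : LineModule) : Prop :=
  ∃ (k : ℤ) (r s : ℕ),
    ChartModule.Isomorphic (((lineO k).copies r).sum ((lineO (k - 1)).copies s)) F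

/-- `P` is the fibre `F₊(0)`, as a subspace of `F(0)`, of the positive subsheaf
`F₊ = r 𝒪(k)` of an almost balanced bundle `F ≅ r 𝒪(k) ⊕ s 𝒪(k-1)`. Here `r > 0` unless `F = 0`;
this is what makes `F₊` unique (for `F` balanced, `F₊ = F`). -/
def IsPositiveSubspace (F : LineModule) (P : Submodule ℂ (F.fibre lineEv)) : Prop :=
  ∃ (k : ℤ) (r s : ℕ), (r = 0 → s = 0) ∧
    ∃ h : ChartModule.Hom (((lineO k).copies r).sum ((lineO (k - 1)).copies s)) F,
      h.IsIso ∧ P = LinearMap.range ((h.comp (ChartModule.inl _ _)).fibre lineEv)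

end LineModule

/-! ### The rational angle -/

/-- The coordinate ring of a node: pairs of functions on two affine lines that agree at the
origins. It is `ℂ[x, y] / (x y)`, with `x = (X, 0)` and `y = (0, X)`. -/
def nodeRing : Subring (ℂ[X] × ℂ[X]) :=
  RingHom.eqLocus (lineEv.comp (RingHom.fst ℂ[X] ℂ[X])) (lineEv.comp (RingHom.snd ℂ[X] ℂ[X]))

/-- The function `x + y` on the node, whose only zero is the singular point. -/
def nodeT : nodeRing := ⟨(X, X), rfl⟩

/-- Restriction of functions from the node to the complement of the singular point. -/
def angleResU : nodeRing →+* ℂ[T;T⁻¹] × ℂ[T;T⁻¹] :=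
  (RingHom.prodMap lineResU lineResU).comp nodeRing.subtype

/-- Restriction of functions from `Spec ℂ[u] ⊔ Spec ℂ[v]`, where `u = x⁻¹` and `v = y⁻¹`. -/
def angleResV : ℂ[X] × ℂ[X] →+* ℂ[T;T⁻¹] × ℂ[T;T⁻¹] :=
  RingHom.prodMap lineResV lineResV

/-- `C` is a rational angle `C₁ ∪_p C₂`: two projective lines, with affine coordinates `x = u⁻¹`
and `y = v⁻¹`, that meet at the node `p : x = y = 0` only. Here `U = Spec ℂ[x, y] / (x y)` is the
complement of the two points at infinity, `V = Spec ℂ[u] ⊔ Spec ℂ[v]` is the complement of `p`, and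
`U ∩ V = Spec ℂ[x, x⁻¹] ⊔ Spec ℂ[y, y⁻¹]`. -/
structure RationalAngle (C : Scheme.{0}) where
  U : C.Opens
  V : C.Opens
  isAffineOpen_U : IsAffineOpen U
  isAffineOpen_V : IsAffineOpen V
  cover : U ⊔ V = ⊤
  eU : Γ(C, U) ≃+* nodeRing
  eV : Γ(C, V) ≃+* ℂ[X] × ℂ[X]
  eUV : Γ(C, U ⊓ V) ≃+* ℂ[T;T⁻¹] × ℂ[T;T⁻¹]
  eUV_resU : ∀ f : Γ(C, U),
    eUV (C.presheaf.map (homOfLE (inf_le_left : U ⊓ V ≤ U)).op f) = angleResU (eU f)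
  eUV_resV : ∀ f : Γ(C, V),
    eUV (C.presheaf.map (homOfLE (inf_le_right : U ⊓ V ≤ V)).op f) = angleResV (eV f)
  inf_eq_U : U ⊓ V = C.basicOpen (eU.symm nodeT)
  inf_eq_V : U ⊓ V = C.basicOpen (eV.symm (X, X))

/-- A vector bundle: a locally free sheaf of modules of finite rank. -/
def IsVectorBundle {C : Scheme.{0}} (E : C.Modules) : Prop :=
  ∀ x : C, ∃ W : C.Opens, x ∈ W ∧ ∃ n : ℕ,
    Nonempty (E.restrict W.ι ≅ (SheafOfModules.free (Fin n) : (W : Scheme.{0}).Modules))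

/-- Sheaves of modules on the rational angle, in its charts. -/
abbrev AngleModule := ChartModule angleResU angleResV

/-- The sections of a sheaf of modules over the charts of a rational angle. -/
def RationalAngle.sections {C : Scheme.{0}} (S : RationalAngle C) (E : C.Modules) :
    AngleModule :=
  letI : Module nodeRing Γ(E, S.U) := Module.compHom _ S.eU.symm.toRingHom
  letI : Module (ℂ[X] × ℂ[X]) Γ(E, S.V) := Module.compHom _ S.eV.symm.toRingHom
  letI : Module (ℂ[T;T⁻¹] × ℂ[T;T⁻¹]) Γ(E, S.U ⊓ S.V) :=
    Module.compHom _ S.eUV.symm.toRingHom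
  { onU := Γ(E, S.U)
    onV := Γ(E, S.V)
    onUV := Γ(E, S.U ⊓ S.V)
    resU :=
      { toFun := fun m => E.presheaf.map (homOfLE (inf_le_left : S.U ⊓ S.V ≤ S.U)).op m
        map_add' := fun m n => map_add _ m n
        map_smul' := fun a m => by
          change E.presheaf.map _ (S.eU.symm a • m) = S.eUV.symm (angleResU a) • _
          rw [Scheme.Modules.map_smul]
          congr 1
          rw [RingEquiv.eq_symm_apply, S.eUV_resU, RingEquiv.apply_symm_apply] }
    resV :=
      { toFun := fun m => E.presheaf.map (homOfLE (inf_le_right : S.U ⊓ S.V ≤ S.V)).op m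
        map_add' := fun m n => map_add _ m n
        map_smul' := fun a m => by
          change E.presheaf.map _ (S.eV.symm a • m) = S.eUV.symm (angleResV a) • _
          rw [Scheme.Modules.map_smul]
          congr 1
          rw [RingEquiv.eq_symm_apply, S.eUV_resV, RingEquiv.apply_symm_apply] } }

/-- The line bundle `𝒪(a, b)` that has degree `a` on `C₁` and degree `b` on `C₂`. -/
def angleO (a b : ℤ) : AngleModule :=
  ChartModule.glueUnit angleResU angleResV (MulEquiv.prodUnits.symm (unitT a, unitT b))

/-- The node `p`. -/
def nodeEv : nodeRing →+* ℂ := (lineEv.comp (RingHom.fst ℂ[X] ℂ[X])).comp nodeRing.subtype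

namespace AngleModule

/-- The twist `E(a, b) = E ⊗ 𝒪(a, b)`. -/
def twist (E : AngleModule) (a b : ℤ) : AngleModule := E.tensor (angleO a b)

/-- `E` has the form
`r 𝒪(k, l) ⊕ s₁ 𝒪(k, l-1) ⊕ s₂ 𝒪(k-1, l)` or `r₁ 𝒪(k+1, l) ⊕ r₂ 𝒪(k, l+1) ⊕ s 𝒪(k, l)`. -/
def AlmostBalanced (E : AngleModule) : Prop :=
  (∃ (k l : ℤ) (r s₁ s₂ : ℕ), ChartModule.Isomorphic
    ((((angleO k l).copies r).sum ((angleO k (l - 1)).copies s₁)).sum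
      ((angleO (k - 1) l).copies s₂)) E) ∨
  (∃ (k l : ℤ) (r₁ r₂ s : ℕ), ChartModule.Isomorphic
    ((((angleO (k + 1) l).copies r₁).sum ((angleO k (l + 1)).copies r₂)).sum
      ((angleO k l).copies s)) E)

/-- The restriction `E|_{C₁}`. -/
def restrictFst (E : AngleModule) : LineModule :=
  E.pullback lineResU lineResV ((RingHom.fst ℂ[X] ℂ[X]).comp nodeRing.subtype)
    (RingHom.fst ℂ[X] ℂ[X]) (RingHom.fst ℂ[T;T⁻¹] ℂ[T;T⁻¹]) rfl rfl

/-- The restriction `E|_{C₂}`. -/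
def restrictSnd (E : AngleModule) : LineModule :=
  E.pullback lineResU lineResV ((RingHom.snd ℂ[X] ℂ[X]).comp nodeRing.subtype)
    (RingHom.snd ℂ[X] ℂ[X]) (RingHom.snd ℂ[T;T⁻¹] ℂ[T;T⁻¹]) rfl rfl

/-- The canonical isomorphism `E(p) → (E|_{C₁})(p)`, `c ⊗ m ↦ c ⊗ (1 ⊗ m)`. -/
def toFibreFst (E : AngleModule) : E.fibre nodeEv →ₗ[ℂ] E.restrictFst.fibre lineEv :=
  BaseChange.map nodeEv lineEv (RingHom.id ℂ) rfl
    (BaseChange.mk ((RingHom.fst ℂ[X] ℂ[X]).comp nodeRing.subtype) E.onU)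

/-- The canonical isomorphism `E(p) → (E|_{C₂})(p)`, `c ⊗ m ↦ c ⊗ (1 ⊗ m)`. -/
def toFibreSnd (E : AngleModule) : E.fibre nodeEv →ₗ[ℂ] E.restrictSnd.fibre lineEv :=
  BaseChange.map nodeEv lineEv (RingHom.id ℂ)
    (r := (RingHom.snd ℂ[X] ℂ[X]).comp nodeRing.subtype) (RingHom.ext fun f => f.2)
    (BaseChange.mk ((RingHom.snd ℂ[X] ℂ[X]).comp nodeRing.subtype) E.onU)

/-- The restrictions `E|_{C₁}` and `E|_{C₂}` are almost balanced, and their positive subspaces,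
considered in `E(p)`, are in general position: their intersection has the expected dimension
`max 0 (dim P₁ + dim P₂ - dim E(p))` (truncated subtraction of natural numbers). -/
def PositiveGeneralPosition (E : AngleModule) : Prop :=
  E.restrictFst.AlmostBalanced ∧ E.restrictSnd.AlmostBalanced ∧
  ∃ (P₁ : Submodule ℂ (E.restrictFst.fibre lineEv)) (P₂ : Submodule ℂ (E.restrictSnd.fibre lineEv)),
    LineModule.IsPositiveSubspace E.restrictFst P₁ ∧
    LineModule.IsPositiveSubspace E.restrictSnd P₂ ∧
    Module.finrank ℂ ↥(P₁.comap E.toFibreFst ⊓ P₂.comap E.toFibreSnd) =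
      Module.finrank ℂ ↥(P₁.comap E.toFibreFst) + Module.finrank ℂ ↥(P₂.comap E.toFibreSnd) -
        Module.finrank ℂ (E.fibre nodeEv)

/-- Some twist `G = E(-k, -l)` satisfies `H¹(G) = H⁰(G(-1, 0)) = H⁰(G(0, -1)) = 0` or
`H⁰(G) = H¹(G(1, 0)) = H¹(G(0, 1)) = 0`. -/
def TwistVanishing (E : AngleModule) : Prop :=
  ∃ (k l : ℤ) (G : AngleModule), G = E.twist (-k) (-l) ∧
    ((Subsingleton G.H1 ∧ Subsingleton (G.twist (-1) 0).H0 ∧ Subsingleton (G.twist 0 (-1)).H0) ∨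
      (Subsingleton G.H0 ∧ Subsingleton (G.twist 1 0).H1 ∧ Subsingleton (G.twist 0 1).H1))

end AngleModule

end RatAngle

end

namespace RatAngle

/-! ### Sections of a vector bundle over an affine open set -/

open AlgebraicGeometry.Scheme.Modules

open Limits in
/-- The presentation of a free sheaf of modules without relations. -/
noncomputable def freePresentation {C : Scheme.{0}} (I : Type) :
    SheafOfModules.Presentation (R := C.ringCatSheaf) (SheafOfModules.free I) where
  generators := SheafOfModules.free.generatingSections I
  relations :=
    { I := Empty
      s := fun j => j.elim
      epi := IsZero.epi (IsZero.of_iso (isZero_zero _) (Limits.kernel.ofMono _)) _ }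

/-- Quasi-coherence is a local condition. On each trivializing `W` the presentation without
relations is carried along the equivalence between modules on the scheme `W` and modules on the
slice site over `W`. -/
theorem IsVectorBundle.isQuasicoherent {C : Scheme.{0}} {E : C.Modules} (hE : IsVectorBundle E) :
    SheafOfModules.IsQuasicoherent E := by
  choose W hW n e using hE
  refine SheafOfModules.QuasicoherentData.isQuasicoherent (R := C.ringCatSheaf)
    { I := C, X := W, coversTop := ?_, presentation := fun x => ?_ }
  · rw [Opens.coversTop_iff, TopologicalSpace.IsOpenCover, eq_top_iff]
    intro x _
    exact TopologicalSpace.Opens.mem_iSup.2 ⟨x, hW x⟩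
  · let i1 : (overEquiv (W x)).functor.obj
        ((SheafOfModules.overFunctor C.ringCatSheaf (W x)).obj E) ≅
        SheafOfModules.free (Fin (n x)) :=
      (overFunctorEquiv (W x)).app E ≪≫ (e x).some
    let P1 := @SheafOfModules.Presentation.ofIsIso _ _ _ _ _ _ _ _ i1.inv (Iso.isIso_inv i1)
      (freePresentation (C := (W x : Scheme)) (Fin (n x)))
    let η : SheafOfModules.unit (C.ringCatSheaf.over (W x)) ≅
        (overEquiv (W x)).inverse.obj (SheafOfModules.unit _) :=
      (overEquiv (W x)).unitIso.app _ ≪≫ (overEquiv (W x)).inverse.mapIso (Iso.refl _)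
    let F : SheafOfModules.{0} (W x).toScheme.ringCatSheaf ⥤
        SheafOfModules.{0} (C.ringCatSheaf.over (W x)) :=
      (overEquiv (W x)).inverse
    have hF : F.IsEquivalence := inferInstanceAs (overEquiv (W x)).inverse.IsEquivalence
    have : Limits.PreservesColimitsOfSize.{0, 0} F := inferInstance
    let P2 := P1.map F η
    exact @SheafOfModules.Presentation.ofIsIso _ _ _ _ _ _ _ _
      ((overEquiv (W x)).unitIso.app ((SheafOfModules.overFunctor C.ringCatSheaf (W x)).obj E)).inv
      (Iso.isIso_inv _) P2

variable {C : Scheme.{0}} {U : C.Opens} (hU : IsAffineOpen U)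

theorem image_fromSpec_le (V : (Spec Γ(C, U)).Opens) : hU.fromSpec ''ᵁ V ≤ U := by
  have := hU.fromSpec.image_le_opensRange V
  rwa [hU.opensRange_fromSpec] at this

/-- The two actions of `Γ(C, U)`, through the spectrum and through restriction on `C`, agree because
`fromSpec` induces on sections the canonical map followed by restriction. -/
theorem smul_restrict_fromSpec (E : C.Modules) (V : (Spec Γ(C, U)).Opens) (r : Γ(C, U))
    (x : Γ(E.restrict hU.fromSpec, V)) :
    (E.restrictAppIso hU.fromSpec V).hom (r • x) =
      C.presheaf.map (homOfLE (image_fromSpec_le hU V)).op r •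
        (E.restrictAppIso hU.fromSpec V).hom x := by
  rw [smul_Spec_def, smul_restrictAppIso_hom_apply]
  congr 1
  have h := hU.fromSpec.appLE_appIso_inv (U := U) (V := V)
    (by rw [hU.fromSpec_preimage_self]; exact le_top)
  rw [← ConcreteCategory.comp_apply, ← ConcreteCategory.comp_apply]
  have h2 : hU.fromSpec.appLE U V (by rw [hU.fromSpec_preimage_self]; exact le_top) =
      (Scheme.ΓSpecIso Γ(C, U)).inv ≫ (Spec Γ(C, U)).presheaf.map V.leTop.op := by
    rw [Scheme.Hom.appLE, hU.fromSpec_app_self, Category.assoc, ← Functor.map_comp]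
    rfl
  rw [h2, Category.assoc] at h
  exact congr($h r)

theorem isLocalizing_restrict_fromSpec (E : C.Modules) [SheafOfModules.IsQuasicoherent E] :
    IsLocalizing (modulesSpecToSheaf.obj (E.restrict hU.fromSpec)) := by
  rw [← isIso_fromTildeΓ_iff_isLocalizing]
  infer_instance

theorem map_smul_restrict_fromSpec (E : C.Modules) (V : (Spec Γ(C, U)).Opens) {W : C.Opens}
    (hW : W = hU.fromSpec ''ᵁ V) (hWU : W ≤ U) (r : Γ(C, U)) (x : Γ(E.restrict hU.fromSpec, V)) :
    E.presheaf.map (eqToHom hW).op ((E.restrictAppIso hU.fromSpec V).hom (r • x)) =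
      C.presheaf.map (homOfLE hWU).op r •
        E.presheaf.map (eqToHom hW).op ((E.restrictAppIso hU.fromSpec V).hom x) := by
  rw [smul_restrict_fromSpec, Scheme.Modules.map_smul]
  congr 1
  rw [← ConcreteCategory.comp_apply, ← Functor.map_comp]
  rfl

/-- Sections over an affine open set, as global sections over its spectrum. -/
noncomputable def sectionsEquivSpec (E : C.Modules) :
    Γ(E.restrict hU.fromSpec, ⊤) ≃ₗ[Γ(C, U)] Γ(E, U) :=
  have hW : U = hU.fromSpec ''ᵁ ⊤ := by
    rw [Scheme.Hom.image_top_eq_opensRange, hU.opensRange_fromSpec]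
  { ((E.restrictAppIso hU.fromSpec ⊤) ≪≫
      E.presheaf.mapIso (eqToIso hW).op).addCommGroupIsoToAddEquiv with
    map_smul' := fun r x => by
      refine (map_smul_restrict_fromSpec hU E ⊤ hW le_rfl r x).trans ?_
      congr 1
      exact congr($(C.presheaf.map_id (.op U)) r) }

/-- With `exists_pow_smul_eq_zero`, this says that sections over the basic open set of `f` are the
localization at `f` of the sections over `U`; both are transported from the spectrum, where a
quasi-coherent module is localizing. -/
theorem exists_pow_smul_eq_map (hU : IsAffineOpen U) (E : C.Modules)
    [SheafOfModules.IsQuasicoherent E] (f : Γ(C, U))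
    (s : Γ(E, C.basicOpen f)) : ∃ (n : ℕ) (t : Γ(E, U)),
      C.presheaf.map (homOfLE (C.basicOpen_le f)).op f ^ n • s =
        E.presheaf.map (homOfLE (C.basicOpen_le f)).op t := by
  have hW : C.basicOpen f = hU.fromSpec ''ᵁ (PrimeSpectrum.basicOpen f) :=
    (hU.fromSpec_image_basicOpen f).symm
  have := isLocalizing_restrict_fromSpec hU E f
  let D : (Spec Γ(C, U)).Opens := PrimeSpectrum.basicOpen f
  let i : Γ(E.restrict hU.fromSpec, D) ≅ Γ(E, C.basicOpen f) :=
    E.restrictAppIso hU.fromSpec D ≪≫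
      E.presheaf.mapIso (eqToIso hW).op
  obtain ⟨⟨t, ⟨_, n, rfl⟩⟩, h⟩ := IsLocalizedModule.surj (Submonoid.powers f)
    ((modulesSpecToSheaf.obj (E.restrict hU.fromSpec)).obj.map
      (PrimeSpectrum.basicOpen f).leTop.op).hom (i.inv s)
  refine ⟨n, sectionsEquivSpec hU E t, ?_⟩
  have h2 := congr(i.hom $h)
  have h3 := map_smul_restrict_fromSpec hU E D hW (C.basicOpen_le f) (f ^ n) (i.inv s)
  have h4 : i.hom (f ^ n • (i.inv s : Γ(E.restrict hU.fromSpec, D))) =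
      C.presheaf.map (homOfLE (C.basicOpen_le f)).op (f ^ n) • s := by
    refine h3.trans ?_
    congr 1
    exact congr($(i.inv_hom_id) s)
  rw [← map_pow, ← h4]
  refine h2.trans ?_
  -- Both sides are composites of restriction maps, and there is only one restriction map between
  -- two given open sets.
  refine (congr($(E.presheaf.map_comp _ _) _)).symm.trans ?_
  refine Eq.trans ?_ (congr($(E.presheaf.map_comp _ _) _))
  rfl

theorem exists_pow_smul_eq_zero (hU : IsAffineOpen U) (E : C.Modules)
    [SheafOfModules.IsQuasicoherent E] (f : Γ(C, U))
    (t : Γ(E, U)) (ht : E.presheaf.map (homOfLE (C.basicOpen_le f)).op t = 0) :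
    ∃ n : ℕ, f ^ n • t = 0 := by
  have hW : C.basicOpen f = hU.fromSpec ''ᵁ (PrimeSpectrum.basicOpen f) :=
    (hU.fromSpec_image_basicOpen f).symm
  have := isLocalizing_restrict_fromSpec hU E f
  obtain ⟨⟨_, n, rfl⟩, hn⟩ := (IsLocalizedModule.eq_zero_iff (Submonoid.powers f)
    ((modulesSpecToSheaf.obj (E.restrict hU.fromSpec)).obj.map
      (PrimeSpectrum.basicOpen f).leTop.op).hom
      (m := (sectionsEquivSpec hU E).symm t)).1 (by
    have := congr(E.presheaf.map (eqToHom hW.symm).op $ht)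
    rw [map_zero] at this
    refine Eq.trans ?_ this
    refine (congr($(E.presheaf.map_comp _ _) _)).symm.trans ?_
    refine Eq.trans ?_ (congr($(E.presheaf.map_comp _ _) _))
    rfl)
  refine ⟨n, (sectionsEquivSpec hU E).symm.injective ?_⟩
  rw [map_zero, _root_.map_smul]
  exact hn

/-- The global sections of a free sheaf on an affine scheme. -/
noncomputable def freeSectionsEquiv (R : CommRingCat.{0}) (I : Type) (N : (Spec R).Modules)
    (e : N ≅ SheafOfModules.free I) : (I →₀ R) ≃ₗ[R] Γ(N, ⊤) :=
  (tilde.isoTop (ModuleCat.of R (I →₀ R)) ≪≫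
    moduleSpecΓFunctor.mapIso (tildeFinsupp I ≪≫ e.symm)).toLinearEquiv

/-- The restriction of a free sheaf along an open immersion is free. -/
noncomputable def restrictFreeIso {X Y : Scheme.{0}} (f : X ⟶ Y) [IsOpenImmersion f] (I : Type) :
    Scheme.Modules.restrict (SheafOfModules.free I : Y.Modules) f ≅
      (SheafOfModules.free I : X.Modules) :=
  let F : SheafOfModules.{0} Y.ringCatSheaf ⥤ SheafOfModules.{0} X.ringCatSheaf := restrictFunctor f
  have : F.IsLeftAdjoint := inferInstanceAs (restrictFunctor f).IsLeftAdjoint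
  (SheafOfModules.mapFreeIso F I (restrictUnitIso f).symm).symm

/-- The inclusion of `U` factors as `Spec Γ(C, U) ⟶ W ⟶ C`, so the trivialization over `W` pulls
back to the spectrum, where a free sheaf has free global sections. -/
theorem exists_basis_of_restrict_iso_free {E : C.Modules} {W : C.Opens} {n : ℕ}
    (e : E.restrict W.ι ≅ (SheafOfModules.free (Fin n) : (W : Scheme.{0}).Modules))
    (hU : IsAffineOpen U) (hUW : U ≤ W) : Nonempty (Module.Basis (Fin n) Γ(C, U) Γ(E, U)) := by
  let j : Spec Γ(C, U) ⟶ (W : Scheme) := hU.isoSpec.inv ≫ C.homOfLE hUW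
  have hj : j ≫ W.ι = hU.fromSpec := by simp [j]
  have i : E.restrict hU.fromSpec ≅ SheafOfModules.free (Fin n) :=
    (restrictFunctorCongr hj).symm.app E ≪≫ (restrictFunctorComp j W.ι).app E ≪≫
      (restrictFunctor j).mapIso e ≪≫ restrictFreeIso j (Fin n)
  exact ⟨⟨((freeSectionsEquiv _ _ _ i).trans (sectionsEquivSpec hU E)).symm⟩⟩

/-- Basic open sets inside trivializing sets cover `U`, and a cover of an affine open set by basic
open sets is the same as a family of functions generating the unit ideal. -/
theorem exists_span_free {E : C.Modules} (hE : IsVectorBundle E) (hU : IsAffineOpen U) :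
    ∃ s : Set Γ(C, U), Ideal.span s = ⊤ ∧ ∀ f ∈ s, ∃ n : ℕ,
      Nonempty (Module.Basis (Fin n) Γ(C, C.basicOpen f) Γ(E, C.basicOpen f)) := by
  refine ⟨{f | ∃ n : ℕ, Nonempty (Module.Basis (Fin n) Γ(C, C.basicOpen f) Γ(E, C.basicOpen f))},
    ?_, fun f hf => hf⟩
  rw [← hU.iSup_basicOpen_eq_self_iff, le_antisymm_iff]
  refine ⟨iSup_le fun f => C.basicOpen_le _, fun x hx => ?_⟩
  obtain ⟨W, hxW, n, ⟨e⟩⟩ := hE x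
  obtain ⟨f, hf, hxf⟩ := hU.exists_basicOpen_le ⟨x, hxW⟩ hx
  exact TopologicalSpace.Opens.mem_iSup.2
    ⟨⟨f, n, exists_basis_of_restrict_iso_free e (hU.basicOpen f) hf⟩, hxf⟩

/-- Finiteness and flatness can be checked on localizations at a family generating the unit ideal,
and these localizations are free here. -/
theorem finite_and_flat_sections {E : C.Modules} (hE : IsVectorBundle E) (hU : IsAffineOpen U) :
    Module.Finite Γ(C, U) Γ(E, U) ∧ Module.Flat Γ(C, U) Γ(E, U) := by
  have := hE.isQuasicoherent
  obtain ⟨s, hs, h⟩ := exists_span_free hE hU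
  let alg (f : s) : Algebra Γ(C, U) Γ(C, C.basicOpen f.1) :=
    (C.presheaf.map (homOfLE (C.basicOpen_le f.1)).op).hom.toAlgebra
  let mod (f : s) : Module Γ(C, U) Γ(E, C.basicOpen f.1) :=
    Module.compHom _ (C.presheaf.map (homOfLE (C.basicOpen_le f.1)).op).hom
  have tow (f : s) : IsScalarTower Γ(C, U) Γ(C, C.basicOpen f.1) Γ(E, C.basicOpen f.1) :=
    IsScalarTower.of_algebraMap_smul fun _ _ => rfl
  have loc (f : s) : IsLocalization.Away f.1 Γ(C, C.basicOpen f.1) :=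
    hU.isLocalization_basicOpen f.1
  let res (f : s) : Γ(E, U) →ₗ[Γ(C, U)] Γ(E, C.basicOpen f.1) :=
    { toFun := E.presheaf.map (homOfLE (C.basicOpen_le f.1)).op
      map_add' := map_add _
      map_smul' := fun r x => Scheme.Modules.map_smul E _ r x }
  have hres (f : s) : IsLocalizedModule.Away f.1 (res f) := by
    refine IsLocalizedModule.Away.mk_of_addCommGroup ?_ (fun q => ?_) (fun t ht => ?_)
    · have h1 : IsUnit (algebraMap Γ(C, U) Γ(C, C.basicOpen f.1) f.1) :=
        IsLocalization.Away.algebraMap_isUnit f.1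
      have h2 := ((Module.End.isUnit_iff _).1 (h1.map (algebraMap Γ(C, C.basicOpen f.1)
        (Module.End Γ(C, C.basicOpen f.1) Γ(E, C.basicOpen f.1)))))
      exact (Module.End.isUnit_iff _).2 h2
    · obtain ⟨n, t, h⟩ := exists_pow_smul_eq_map hU E f.1 q
      refine ⟨n, t, Eq.trans ?_ h⟩
      rw [← map_pow]
      rfl
    · exact exists_pow_smul_eq_zero hU E f.1 t ht
  have hfin (f : s) : Module.Finite Γ(C, C.basicOpen f.1) Γ(E, C.basicOpen f.1) := by
    obtain ⟨n, ⟨b⟩⟩ := h f.1 f.2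
    exact Module.Finite.of_basis b
  have hflat (f : s) : Module.Flat Γ(C, U) Γ(E, C.basicOpen f.1) := by
    obtain ⟨n, ⟨b⟩⟩ := h f.1 f.2
    have := Module.Free.of_basis b
    have := IsLocalization.flat Γ(C, C.basicOpen f.1) (Submonoid.powers f.1)
    exact Module.Flat.trans Γ(C, U) Γ(C, C.basicOpen f.1) _
  exact ⟨Module.Finite.of_localizationSpan' s hs res hfin,
    Module.flat_of_isLocalized_span _ _ s hs _ res hflat⟩

end RatAngle

/-- The equational criterion writes `m` as a combination `∑ g j • y j` with `a * g j = 0`, and each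
`g j` is a multiple of `b`. Two uses: `b = 0` says that a regular element stays regular on `M`; on
the node, with `a`, `b` the coordinates of the two branches, it says that sections killed by `x` are
multiples of `y`. -/
theorem Module.Flat.exists_eq_smul_of_smul_eq_zero {A M : Type*} [CommRing A] [AddCommGroup M]
    [Module A M] [Module.Flat A M] {a b : A} (hab : ∀ c, a * c = 0 → ∃ d, c = b * d) {m : M}
    (hm : a • m = 0) : ∃ m', m = b • m' := by
  obtain ⟨κ, g, y, hx, hf⟩ := Module.Flat.isTrivialRelation_of_sum_smul_eq_zero
    (f := fun _ : Unit => a) (x := fun _ => m) (by simpa using hm)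
  choose d hd using fun j => hab (g () j) (by simpa using hf j)
  refine ⟨∑ j, d j • y j, (hx ()).trans ?_⟩
  simp_rw [Finset.smul_sum, smul_smul, ← hd]

/-! ### The chart data of a vector bundle on a rational angle -/

namespace RatAngle

/-- The properties of the sections over the charts of a vector bundle on a rational angle that
are used below. -/
structure AngleModule.IsBundle (E : AngleModule) : Prop where
  finite_onU : Module.Finite nodeRing E.onU
  exists_eq_smul : ∀ a b : nodeRing, (∀ c, a * c = 0 → ∃ d, c = b * d) →
    ∀ m : E.onU, a • m = 0 → ∃ m', m = b • m'
  resU_injective : Function.Injective E.resU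
  exists_resU : ∀ q : E.onUV, ∃ (n : ℕ) (m : E.onU), angleResU nodeT ^ n • q = E.resU m
  exists_resV : ∀ q : E.onUV, ∃ (n : ℕ) (m : E.onV), angleResV (X, X) ^ n • q = E.resV m

section Localization

variable {C : Scheme.{0}} {U : C.Opens}

theorem exists_pow_smul_eq_map_of_eq (hU : IsAffineOpen U) (E : C.Modules)
    [SheafOfModules.IsQuasicoherent E] (f : Γ(C, U)) {W : C.Opens} (hW : W = C.basicOpen f)
    (hWU : W ≤ U) (s : Γ(E, W)) : ∃ (n : ℕ) (t : Γ(E, U)),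
      C.presheaf.map (homOfLE hWU).op f ^ n • s = E.presheaf.map (homOfLE hWU).op t := by
  subst hW
  exact exists_pow_smul_eq_map hU E f s

theorem map_injective_of_eq_basicOpen (hU : IsAffineOpen U) (E : C.Modules)
    (hE : IsVectorBundle E) (f : Γ(C, U)) (hf : ∀ c, f * c = 0 → c = 0) {W : C.Opens}
    (hW : W = C.basicOpen f) (hWU : W ≤ U) :
    Function.Injective (E.presheaf.map (homOfLE hWU).op) := by
  subst hW
  have := hE.isQuasicoherent
  have := (finite_and_flat_sections hE hU).2
  rw [injective_iff_map_eq_zero]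
  intro t ht
  obtain ⟨n, hn⟩ := exists_pow_smul_eq_zero hU E f t ht
  obtain ⟨m, hm⟩ := Module.Flat.exists_eq_smul_of_smul_eq_zero (a := f ^ n) (b := 0) (by
    intro c hc
    have hreg : IsLeftRegular (f ^ n) := (isLeftRegular_iff_right_eq_zero_of_mul.2 hf).pow n
    exact ⟨0, by simpa using isLeftRegular_iff_right_eq_zero_of_mul.1 hreg c hc⟩) hn
  simpa using hm

end Localization

/-- This is the passage from sheaves to modules: nothing about the scheme or about local freeness is
used later except these properties. -/
theorem RationalAngle.isBundle_sections {C : Scheme.{0}} (S : RationalAngle C) {E : C.Modules}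
    (hE : IsVectorBundle E) : (S.sections E).IsBundle := by
  have hq := hE.isQuasicoherent
  obtain ⟨hfin, hflat⟩ := finite_and_flat_sections hE S.isAffineOpen_U
  refine ⟨?_, fun a b hab m hm => ?_, ?_, fun q => ?_, fun q => ?_⟩
  · let σ : Γ(C, S.U) →+* nodeRing := S.eU.toRingHom
    have : RingHomSurjective σ := ⟨S.eU.surjective⟩
    let f : Γ(E, S.U) →ₛₗ[σ] (S.sections E).onU :=
      { toFun := fun m => m
        map_add' := fun _ _ => rfl
        map_smul' := fun r m => by
          change r • m = S.eU.symm (S.eU r) • m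
          rw [RingEquiv.symm_apply_apply] }
    exact Module.Finite.of_surjective f fun m => ⟨m, rfl⟩
  · obtain ⟨m', h⟩ := Module.Flat.exists_eq_smul_of_smul_eq_zero (M := Γ(E, S.U))
      (a := S.eU.symm a) (b := S.eU.symm b) (fun c hc => by
        obtain ⟨d, hd⟩ := hab (S.eU c) (S.eU.symm.injective (by simpa using hc))
        refine ⟨S.eU.symm d, S.eU.injective (by simpa using hd)⟩) (m := m) hm
    exact ⟨m', h⟩
  · refine map_injective_of_eq_basicOpen S.isAffineOpen_U E hE _ (fun c hc => ?_) S.inf_eq_U _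
    -- The function `x + y` is a nonzerodivisor of the node ring, because it restricts to the
    -- coordinate on either branch.
    have h : nodeT * S.eU c = 0 := S.eU.symm.injective (by simpa using hc)
    apply S.eU.injective
    rw [map_zero]
    have h' := congrArg Subtype.val h
    refine Subtype.ext (Prod.ext ?_ ?_)
    · exact (mul_eq_zero.1 (congrArg Prod.fst h')).resolve_left Polynomial.X_ne_zero
    · exact (mul_eq_zero.1 (congrArg Prod.snd h')).resolve_left Polynomial.X_ne_zero
  · suffices h : ∀ q : Γ(E, S.U ⊓ S.V), ∃ (n : ℕ) (t : Γ(E, S.U)),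
        S.eUV.symm (angleResU nodeT ^ n) • q = E.presheaf.map (homOfLE inf_le_left).op t from h q
    intro q
    obtain ⟨n, t, h⟩ := exists_pow_smul_eq_map_of_eq S.isAffineOpen_U E _ S.inf_eq_U inf_le_left q
    refine ⟨n, t, Eq.trans ?_ h⟩
    rw [map_pow]
    congr 2
    rw [RingEquiv.symm_apply_eq, S.eUV_resU, RingEquiv.apply_symm_apply]
  · suffices h : ∀ q : Γ(E, S.U ⊓ S.V), ∃ (n : ℕ) (t : Γ(E, S.V)),
        S.eUV.symm (angleResV (X, X) ^ n) • q = E.presheaf.map (homOfLE inf_le_right).op t from h q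
    intro q
    obtain ⟨n, t, h⟩ := exists_pow_smul_eq_map_of_eq S.isAffineOpen_V E _ S.inf_eq_V inf_le_right q
    refine ⟨n, t, Eq.trans ?_ h⟩
    rw [map_pow]
    congr 2
    rw [RingEquiv.symm_apply_eq, S.eUV_resV, RingEquiv.apply_symm_apply]

end RatAngle

/-! ### Base change of bases, frames, and cohomology of twists -/

noncomputable section

namespace RatAngle

namespace BaseChange

variable {A A' : Type} [CommRing A] [CommRing A'] (φ : A →+* A')
  {M : Type} [AddCommGroup M] [Module A M]

/-- A basis of `M` gives a basis of the base change of `M`. -/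
def basis {ι : Type} (b : Module.Basis ι A M) : Module.Basis ι A' (BaseChange φ M) :=
  letI := φ.toAlgebra
  Module.Basis.baseChange A' b

theorem basis_apply {ι : Type} (b : Module.Basis ι A M) (i : ι) :
    basis φ b i = mk φ M (b i) := by
  let := φ.toAlgebra
  exact Module.Basis.baseChange_apply A' b i

theorem map_mk {R R' : Type} [CommRing R] [CommRing R'] (ψ : R →+* R') {r : A →+* R}
    (r' : A' →+* R') (h : r'.comp φ = ψ.comp r) {P : Type} [AddCommGroup P] [Module R P]
    (f : M →ₛₗ[r] P) (m : M) : map φ ψ r' h f (mk φ M m) = mk ψ P (f m) := by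
  refine (lift_tmul φ r' _ _ 1 m).trans ?_
  rw [map_one, one_smul]
  rfl

end BaseChange

namespace ChartModule

variable {A B R : Type} [CommRing A] [CommRing B] [CommRing R] {rA : A →+* R} {rB : B →+* R}

/-- Bases over the two charts and their intersection that exhibit a sheaf of modules as a direct
sum of the line bundles `glueUnit (c i)`. -/
structure Frame (E : ChartModule rA rB) {ι : Type} (c : ι → Rˣ) where
  U : Module.Basis ι A E.onU
  V : Module.Basis ι B E.onV
  UV : Module.Basis ι R E.onUV
  resU : ∀ i, E.resU (U i) = UV i
  resV : ∀ i, E.resV (V i) = (c i : R) • UV i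

namespace Frame

variable {E F : ChartModule rA rB} {ι κ : Type} {c : ι → Rˣ} {d : κ → Rˣ}

/-- The standard frame of `n` copies of a line bundle. -/
def copies (c : Rˣ) (n : ℕ) : Frame ((glueUnit rA rB c).copies n) (fun _ : Fin n => c) where
  U := Pi.basisFun A (Fin n)
  V := Pi.basisFun B (Fin n)
  UV := Pi.basisFun R (Fin n)
  resU := fun i => by
    funext j
    change rA (Pi.basisFun A (Fin n) i j) = Pi.basisFun R (Fin n) i j
    simp only [Pi.basisFun_apply, Pi.single_apply]
    split_ifs <;> simp
  resV := fun i => by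
    funext j
    change c * rB (Pi.basisFun B (Fin n) i j) = c * Pi.basisFun R (Fin n) i j
    simp only [Pi.basisFun_apply, Pi.single_apply]
    split_ifs <;> simp

/-- The frame of a direct sum. -/
def sum (e : Frame E c) (f : Frame F d) : Frame (E.sum F) (Sum.elim c d) where
  U := e.U.prod f.U
  V := e.V.prod f.V
  UV := e.UV.prod f.UV
  resU := by
    rintro (i | i)
    · change (E.resU (e.U.prod f.U (Sum.inl i)).1, F.resU (e.U.prod f.U (Sum.inl i)).2) =
        ((e.UV.prod f.UV (Sum.inl i)).1, (e.UV.prod f.UV (Sum.inl i)).2)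
      refine Prod.ext ?_ ?_ <;> simp [e.resU]
    · change (E.resU (e.U.prod f.U (Sum.inr i)).1, F.resU (e.U.prod f.U (Sum.inr i)).2) =
        ((e.UV.prod f.UV (Sum.inr i)).1, (e.UV.prod f.UV (Sum.inr i)).2)
      refine Prod.ext ?_ ?_ <;> simp [f.resU]
  resV := by
    rintro (i | i)
    · change (E.resV (e.V.prod f.V (Sum.inl i)).1, F.resV (e.V.prod f.V (Sum.inl i)).2) =
        ((c i : R) • (e.UV.prod f.UV (Sum.inl i)).1, (c i : R) • (e.UV.prod f.UV (Sum.inl i)).2)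
      refine Prod.ext ?_ ?_ <;> simp [e.resV]
    · change (E.resV (e.V.prod f.V (Sum.inr i)).1, F.resV (e.V.prod f.V (Sum.inr i)).2) =
        ((d i : R) • (e.UV.prod f.UV (Sum.inr i)).1, (d i : R) • (e.UV.prod f.UV (Sum.inr i)).2)
      refine Prod.ext ?_ ?_ <;> simp [f.resV]

/-- Transport of a frame along an isomorphism. -/
def map (e : Frame E c) (h : Hom E F) (hh : h.IsIso) : Frame F c where
  U := e.U.map (LinearEquiv.ofBijective h.onU hh.1)
  V := e.V.map (LinearEquiv.ofBijective h.onV hh.2.1)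
  UV := e.UV.map (LinearEquiv.ofBijective h.onUV hh.2.2)
  resU := fun i => by simp [← h.comm_U, e.resU]
  resV := fun i => by simp [← h.comm_V, e.resV]

theorem map_U (e : Frame E c) (h : Hom E F) (hh : h.IsIso) (i : ι) :
    (e.map h hh).U i = h.onU (e.U i) := rfl

/-- Change of the index type of a frame. -/
def reindex (e : Frame E c) (σ : ι ≃ κ) (hd : ∀ i, d (σ i) = c i) : Frame E d where
  U := e.U.reindex σ
  V := e.V.reindex σ
  UV := e.UV.reindex σ
  resU := fun i => by simp [e.resU]
  resV := fun i => by simp [e.resV, ← hd]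

theorem reindex_U (e : Frame E c) (σ : ι ≃ κ) (hd : ∀ i, d (σ i) = c i) (i : ι) :
    (e.reindex σ hd).U (σ i) = e.U i := by
  simp [reindex]

/-- The morphism that maps one frame to another. -/
def hom (e : Frame E c) (f : Frame F c) : Hom E F where
  onU := e.U.equiv f.U (Equiv.refl ι)
  onV := e.V.equiv f.V (Equiv.refl ι)
  onUV := e.UV.equiv f.UV (Equiv.refl ι)
  comm_U := fun m => by
    have h : ((e.UV.equiv f.UV (Equiv.refl ι)).toLinearMap).comp E.resU =
        F.resU.comp (e.U.equiv f.U (Equiv.refl ι)).toLinearMap :=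
      e.U.ext fun i => by simp [e.resU, f.resU]
    exact LinearMap.congr_fun h m
  comm_V := fun m => by
    have h : ((e.UV.equiv f.UV (Equiv.refl ι)).toLinearMap).comp E.resV =
        F.resV.comp (e.V.equiv f.V (Equiv.refl ι)).toLinearMap :=
      e.V.ext fun i => by simp [e.resV, f.resV]
    exact LinearMap.congr_fun h m

theorem hom_onU (e : Frame E c) (f : Frame F c) (i : ι) : (e.hom f).onU (e.U i) = f.U i := by
  simp [hom]

theorem hom_isIso (e : Frame E c) (f : Frame F c) : (e.hom f).IsIso :=
  ⟨(e.U.equiv f.U (Equiv.refl ι)).bijective, (e.V.equiv f.V (Equiv.refl ι)).bijective,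
    (e.UV.equiv f.UV (Equiv.refl ι)).bijective⟩

/-- The frame of a pullback. -/
def pullback {A' B' R' : Type} [CommRing A'] [CommRing B'] [CommRing R'] (e : Frame E c)
    (rA' : A' →+* R') (rB' : B' →+* R') (α : A →+* A') (β : B →+* B') (ρ : R →+* R')
    (hα : rA'.comp α = ρ.comp rA) (hβ : rB'.comp β = ρ.comp rB) :
    Frame (E.pullback rA' rB' α β ρ hα hβ) (fun i => Units.map ρ.toMonoidHom (c i)) where
  U := BaseChange.basis α e.U
  V := BaseChange.basis β e.V
  UV := BaseChange.basis ρ e.UV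
  resU := fun i => by
    refine (congrArg (BaseChange.map α ρ rA' hα E.resU) (BaseChange.basis_apply α e.U i)).trans ?_
    refine Eq.trans ?_ (BaseChange.basis_apply ρ e.UV i).symm
    exact (BaseChange.map_mk α ρ rA' hα E.resU (e.U i)).trans
      (congrArg (BaseChange.mk ρ E.onUV) (e.resU i))
  resV := fun i => by
    refine (congrArg (BaseChange.map β ρ rB' hβ E.resV) (BaseChange.basis_apply β e.V i)).trans ?_
    refine Eq.trans ?_ (congrArg (ρ (c i) • ·) (BaseChange.basis_apply ρ e.UV i).symm)
    refine (BaseChange.map_mk β ρ rB' hβ E.resV (e.V i)).trans ?_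
    exact (congrArg (BaseChange.mk ρ E.onUV) (e.resV i)).trans
      ((BaseChange.mk ρ E.onUV).map_smulₛₗ (c i : R) (e.UV i))

end Frame

/-! ### Vanishing of cohomology -/

/-- The twist of `E` by `glueUnit c` has no global sections. -/
def H0Zero (E : ChartModule rA rB) (c : Rˣ) : Prop :=
  ∀ m n, E.resU m = (c : R) • E.resV n → m = 0 ∧ n = 0

/-- The twist of `E` by `glueUnit c` has no first cohomology. -/
def H1Zero (E : ChartModule rA rB) (c : Rˣ) : Prop :=
  ∀ q, ∃ m n, q = E.resU m + (c : R) • E.resV n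

theorem subsingleton_H0_iff (E : ChartModule rA rB) : Subsingleton E.H0 ↔ E.H0Zero 1 := by
  constructor
  · intro h m n hmn
    have h0 : (⟨(m, n), by
        change E.resU m - E.resV n = 0
        rw [hmn, Units.val_one, one_smul, sub_self]⟩ : E.H0) = 0 := Subsingleton.elim _ _
    have := congrArg Subtype.val h0
    exact ⟨congrArg Prod.fst this, congrArg Prod.snd this⟩
  · intro h
    refine subsingleton_of_forall_eq 0 fun x => Subtype.ext ?_
    have hx : E.resU x.1.1 - E.resV x.1.2 = 0 := x.2
    obtain ⟨h1, h2⟩ := h x.1.1 x.1.2 (by rw [Units.val_one, one_smul]; exact sub_eq_zero.1 hx)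
    exact Prod.ext h1 h2

theorem subsingleton_H1_iff (E : ChartModule rA rB) : Subsingleton E.H1 ↔ E.H1Zero 1 := by
  rw [QuotientAddGroup.subsingleton_iff, AddSubgroup.eq_top_iff']
  refine forall_congr' fun q => ⟨?_, ?_⟩
  · rintro ⟨⟨m, n⟩, h⟩
    -- The Čech differential is a difference while `H1Zero` is stated with a sum, hence the sign.
    refine ⟨m, -n, ?_⟩
    rw [← h, Units.val_one, one_smul, map_neg, ← sub_eq_add_neg]
    rfl
  · rintro ⟨m, n, h⟩
    refine ⟨(m, -n), ?_⟩
    rw [h, Units.val_one, one_smul]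
    change E.resU m - E.resV (-n) = _
    rw [map_neg, sub_neg_eq_add]

section Twist

variable (E : ChartModule rA rB) (d : Rˣ)

/-- Trivialization of a twist over `U`. -/
def twistU : E.onU ≃ₗ[A] (E.tensor (glueUnit rA rB d)).onU := (TensorProduct.rid A E.onU).symm

/-- Trivialization of a twist over `V`. -/
def twistV : E.onV ≃ₗ[B] (E.tensor (glueUnit rA rB d)).onV := (TensorProduct.rid B E.onV).symm

/-- Trivialization of a twist over `U ∩ V`. -/
def twistUV : E.onUV ≃ₗ[R] (E.tensor (glueUnit rA rB d)).onUV := (TensorProduct.rid R E.onUV).symm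

theorem tensor_glueUnit_resU (m : E.onU) :
    (E.tensor (glueUnit rA rB d)).resU (E.twistU d m) = E.twistUV d (E.resU m) := by
  refine (TensorProduct.map_tmul _ _ _ _).trans ?_
  exact congrArg (fun z : R => E.resU m ⊗ₜ[R] z) (map_one rA)

theorem tensor_glueUnit_resV (m : E.onV) :
    (E.tensor (glueUnit rA rB d)).resV (E.twistV d m) = E.twistUV d ((d : R) • E.resV m) := by
  refine (TensorProduct.map_tmul _ _ _ _).trans ?_
  refine (congrArg (fun z : R => E.resV m ⊗ₜ[R] z)
    (show (d : R) * rB 1 = (d : R) • (1 : R) by simp)).trans ?_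
  exact (TensorProduct.tmul_smul _ _ _).trans (TensorProduct.smul_tmul' _ _ _)

/-- Twisting by a line bundle only multiplies the gluing unit, so the cohomology of iterated twists
can be read off from the sections of `E` itself, without tensor products. -/
theorem tensor_H0Zero_iff (c : Rˣ) :
    (E.tensor (glueUnit rA rB d)).H0Zero c ↔ E.H0Zero (c * d) := by
  simp only [ChartModule.H0Zero]
  rw [(E.twistU d).surjective.forall]
  refine forall_congr' fun m => ?_
  rw [(E.twistV d).surjective.forall]
  refine forall_congr' fun n => ?_
  rw [tensor_glueUnit_resU, tensor_glueUnit_resV, ← map_smul, (E.twistUV d).injective.eq_iff,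
    Units.val_mul, mul_smul, LinearEquiv.map_eq_zero_iff, LinearEquiv.map_eq_zero_iff]

theorem tensor_H1Zero_iff (c : Rˣ) :
    (E.tensor (glueUnit rA rB d)).H1Zero c ↔ E.H1Zero (c * d) := by
  simp only [ChartModule.H1Zero]
  rw [(E.twistUV d).surjective.forall]
  refine forall_congr' fun q => ?_
  rw [(E.twistU d).surjective.exists]
  refine exists_congr fun m => ?_
  rw [(E.twistV d).surjective.exists]
  refine exists_congr fun n => ?_
  rw [tensor_glueUnit_resU, tensor_glueUnit_resV, ← map_smul, ← map_add,
    (E.twistUV d).injective.eq_iff, Units.val_mul, mul_smul]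

end Twist

section FrameVanishing

variable {E : ChartModule rA rB} {ι : Type} [Fintype ι] {c : ι → Rˣ}

theorem Frame.resU_sum (e : Frame E c) (m : E.onU) :
    E.resU m = ∑ i, rA (e.U.repr m i) • e.UV i := by
  conv_lhs => rw [← e.U.sum_repr m]
  rw [map_sum]
  exact Finset.sum_congr rfl fun i _ => by rw [E.resU.map_smulₛₗ, e.resU]

theorem Frame.resV_sum (e : Frame E c) (m : E.onV) :
    E.resV m = ∑ i, (c i * rB (e.V.repr m i)) • e.UV i := by
  conv_lhs => rw [← e.V.sum_repr m]
  rw [map_sum]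
  exact Finset.sum_congr rfl fun i _ => by
    rw [E.resV.map_smulₛₗ, e.resV, smul_smul, mul_comm]

/-- In the coordinates of a frame the gluing condition decouples into one condition for each line
bundle summand; `Frame.H1Zero` rests on the same reduction. -/
theorem Frame.H0Zero (e : Frame E c) (d : Rˣ)
    (h : ∀ i a b, rA a = d * (c i * rB b) → a = 0 ∧ b = 0) : E.H0Zero d := by
  intro m n hmn
  rw [e.resU_sum, e.resV_sum, Finset.smul_sum] at hmn
  simp_rw [smul_smul] at hmn
  have key (i : ι) := h i (e.U.repr m i) (e.V.repr n i) (by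
    have := congrArg (fun q => e.UV.repr q i) hmn
    simpa only [e.UV.repr_sum_self] using this)
  exact ⟨e.U.ext_elem fun i => by simp [(key i).1], e.V.ext_elem fun i => by simp [(key i).2]⟩

theorem Frame.H1Zero (e : Frame E c) (d : Rˣ)
    (h : ∀ i r, ∃ a b, r = rA a + d * (c i * rB b)) : E.H1Zero d := by
  intro q
  choose a b hab using fun i => h i (e.UV.repr q i)
  refine ⟨∑ i, a i • e.U i, ∑ i, b i • e.V i, ?_⟩
  conv_lhs => rw [← e.UV.sum_repr q]
  rw [map_sum, map_sum, Finset.smul_sum, ← Finset.sum_add_distrib]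
  refine Finset.sum_congr rfl fun i _ => ?_
  rw [E.resU.map_smulₛₗ, E.resV.map_smulₛₗ, e.resU, e.resV, smul_smul, smul_smul, ← add_smul, hab]
  ring_nf

end FrameVanishing

end ChartModule

/-! ### Restriction to a branch of the node -/

namespace BaseChange

variable {A A' : Type} [CommRing A] [CommRing A'] (φ : A →+* A')
  {M : Type} [AddCommGroup M] [Module A M]

theorem mk_surjective (hφ : Function.Surjective φ) : Function.Surjective (mk φ M) := by
  let := φ.toAlgebra
  intro x
  change A' ⊗[A] M at x
  induction x using TensorProduct.induction_on with
  | zero => exact ⟨0, map_zero _⟩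
  | tmul a m =>
    obtain ⟨r, rfl⟩ := hφ a
    refine ⟨r • m, ?_⟩
    change (1 : A') ⊗ₜ[A] (r • m) = φ r ⊗ₜ[A] m
    rw [← TensorProduct.smul_tmul, Algebra.smul_def, mul_one]
    rfl
  | add x y hx hy =>
    obtain ⟨m, rfl⟩ := hx
    obtain ⟨n, rfl⟩ := hy
    exact ⟨m + n, map_add _ m n⟩

/-- Right exactness of the tensor product: for surjective `φ`, the base change is `M` modulo `ker φ
• M`. -/
theorem mem_of_mk_eq_zero (hφ : Function.Surjective φ) {m : M} (hm : mk φ M m = 0) :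
    m ∈ RingHom.ker φ • (⊤ : Submodule A M) := by
  let := φ.toAlgebra
  have hex : Function.Exact (Submodule.subtype (RingHom.ker φ)) (Algebra.linearMap A A') := by
    intro a
    simp only [Submodule.subtype_apply, Set.mem_range, Subtype.exists, exists_prop, exists_eq_right]
    exact Iff.rfl
  have h := rTensor_exact M hex hφ
  obtain ⟨z, hz⟩ := (h ((1 : A) ⊗ₜ[A] m)).1 (by
    rw [LinearMap.rTensor_tmul]
    refine Eq.trans ?_ hm
    change φ 1 ⊗ₜ[A] m = (1 : A') ⊗ₜ[A] m
    rw [map_one])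
  have hm' : m = TensorProduct.lid A M ((1 : A) ⊗ₜ[A] m) := by simp
  rw [hm', ← hz]
  clear hz hm hm'
  induction z using TensorProduct.induction_on with
  | zero => simp
  | tmul a m =>
    simp only [LinearMap.rTensor_tmul, Submodule.subtype_apply, lid_tmul]
    exact Submodule.smul_mem_smul a.2 trivial
  | add x y hx hy =>
    rw [map_add, map_add]
    exact add_mem hx hy

theorem smul_eq_zero_of_mk_eq_zero (hφ : Function.Surjective φ) {x : A}
    (hx : ∀ a, φ a = 0 → x * a = 0) {m : M} (hm : mk φ M m = 0) : x • m = 0 := by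
  refine Submodule.smul_induction_on (mem_of_mk_eq_zero φ hφ hm) (fun a ha n _ => ?_)
    (fun a b ha hb => ?_)
  · rw [smul_smul, hx a ha, zero_smul]
  · rw [smul_add, ha, hb, add_zero]

theorem exists_eq_smul_of_mk_eq_zero (hφ : Function.Surjective φ) {y : A}
    (hy : ∀ a, φ a = 0 → ∃ d, a = y * d) {m : M} (hm : mk φ M m = 0) : ∃ m', m = y • m' := by
  refine Submodule.smul_induction_on (mem_of_mk_eq_zero φ hφ hm) (fun a ha n _ => ?_) ?_
  · obtain ⟨d, rfl⟩ := hy a ha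
    exact ⟨d • n, mul_smul _ _ _⟩
  · rintro _ _ ⟨a, rfl⟩ ⟨b, rfl⟩
    exact ⟨a + b, (smul_add _ _ _).symm⟩

end BaseChange

/-- The properties of the sections over the charts of a vector bundle on the projective line that
are used below. -/
structure LineModule.IsBundle (F : LineModule) : Prop where
  finite_onU : Module.Finite ℂ[X] F.onU
  resU_injective : Function.Injective F.resU
  exists_resU : ∀ q : F.onUV, ∃ (n : ℕ) (m : F.onU), (T n : ℂ[T;T⁻¹]) • q = F.resU m
  exists_resV : ∀ q : F.onUV, ∃ (n : ℕ) (m : F.onV), (T (-n) : ℂ[T;T⁻¹]) • q = F.resV m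

theorem lineResU_X_pow (n : ℕ) : lineResU (X ^ n) = T n := by
  simp [lineResU]

theorem lineResU_X : lineResU X = T 1 := by
  simp [lineResU]

theorem lineResV_X_pow (n : ℕ) : lineResV (X ^ n) = T (-n) := by
  simp [lineResV]

theorem lineResV_X : lineResV X = T (-1) := by
  simp [lineResV]

/-- One of the two branches of the node, with the elements that single it out in the coordinate
rings of the charts. -/
structure Branch where
  α : nodeRing →+* ℂ[X]
  β : ℂ[X] × ℂ[X] →+* ℂ[X]
  ρ : ℂ[T;T⁻¹] × ℂ[T;T⁻¹] →+* ℂ[T;T⁻¹]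
  hα : lineResU.comp α = ρ.comp angleResU
  hβ : lineResV.comp β = ρ.comp angleResV
  α_surjective : Function.Surjective α
  β_surjective : Function.Surjective β
  ρ_surjective : Function.Surjective ρ
  ev_comp : lineEv.comp α = nodeEv
  x : nodeRing
  y : nodeRing
  α_x : α x = X
  α_y : α y = 0
  nodeEv_y : nodeEv y = 0
  α_t : α nodeT = X
  β_t : β (X, X) = X
  x_mul : ∀ a, α a = 0 → x * a = 0
  ann_x : ∀ c, x * c = 0 → ∃ d, c = y * d
  ε : ℂ[X] × ℂ[X]
  β_ε : β ε = 1
  ε_mul : ∀ b, β b = 0 → ε * b = 0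
  δ : ℂ[T;T⁻¹] × ℂ[T;T⁻¹]
  δ_mul : ∀ r, ρ r = 0 → δ * r = 0
  resV_ε : angleResV ε = δ
  resU_x : angleResU x = δ * angleResU nodeT

/-- The element `x` of the coordinate ring of the node. -/
def nodeX : nodeRing := ⟨(X, 0), by simp [nodeRing, RingHom.eqLocus, lineEv]⟩

/-- The element `y` of the coordinate ring of the node. -/
def nodeY : nodeRing := ⟨(0, X), by simp [nodeRing, RingHom.eqLocus, lineEv]⟩

theorem nodeRing_ext {a b : nodeRing} (h1 : a.1.1 = b.1.1) (h2 : a.1.2 = b.1.2) : a = b :=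
  Subtype.ext (Prod.ext h1 h2)

theorem nodeRing_eval_eq (a : nodeRing) : a.1.1.eval 0 = a.1.2.eval 0 := a.2

/-- The function on the node that is constant along the first branch. -/
def nodeOfSnd (f : ℂ[X]) : nodeRing :=
  ⟨(C (f.eval 0), f), by simp [nodeRing, RingHom.eqLocus, lineEv]⟩

/-- The function on the node that is constant along the second branch. -/
def nodeOfFst (f : ℂ[X]) : nodeRing :=
  ⟨(f, C (f.eval 0)), by simp [nodeRing, RingHom.eqLocus, lineEv]⟩

/-- The branch `C₁`. -/
def Branch.fst : Branch where
  α := (RingHom.fst ℂ[X] ℂ[X]).comp nodeRing.subtype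
  β := RingHom.fst ℂ[X] ℂ[X]
  ρ := RingHom.fst ℂ[T;T⁻¹] ℂ[T;T⁻¹]
  hα := rfl
  hβ := rfl
  α_surjective := fun f => ⟨nodeOfFst f, rfl⟩
  β_surjective := Prod.fst_surjective
  ρ_surjective := Prod.fst_surjective
  ev_comp := rfl
  x := nodeX
  y := nodeY
  α_x := rfl
  α_y := rfl
  nodeEv_y := by simp [nodeEv, nodeY, lineEv]
  α_t := rfl
  β_t := rfl
  x_mul := fun a ha => nodeRing_ext
    (show X * a.1.1 = 0 by rw [show a.1.1 = 0 from ha, mul_zero]) (zero_mul _)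
  -- A function killed by `x` vanishes on the first branch, hence at the node, so its second
  -- component is divisible by the coordinate. Any extension of the quotient to the node will do,
  -- since `y` kills the first component.
  ann_x := fun c hc => by
    have h1 : X * c.1.1 = 0 := congrArg (fun z : nodeRing => z.1.1) hc
    have h2 : c.1.1 = 0 := (mul_eq_zero.1 h1).resolve_left X_ne_zero
    obtain ⟨f, hf⟩ := X_dvd_iff.2 (show c.1.2.coeff 0 = 0 by
      rw [coeff_zero_eq_eval_zero, ← nodeRing_eval_eq, h2, eval_zero])
    exact ⟨nodeOfSnd f, nodeRing_ext (h2.trans (zero_mul _).symm) hf⟩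
  ε := (1, 0)
  β_ε := rfl
  ε_mul := fun b hb => Prod.ext (by rw [Prod.fst_mul, show b.1 = 0 from hb, mul_zero]; rfl)
    (zero_mul _)
  δ := (1, 0)
  δ_mul := fun b hb => Prod.ext (by rw [Prod.fst_mul, show b.1 = 0 from hb, mul_zero]; rfl)
    (zero_mul _)
  resV_ε := Prod.ext (map_one lineResV) (map_zero lineResV)
  resU_x := Prod.ext (one_mul _).symm ((map_zero lineResU).trans (zero_mul _).symm)

/-- The branch `C₂`. -/
def Branch.snd : Branch where
  α := (RingHom.snd ℂ[X] ℂ[X]).comp nodeRing.subtype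
  β := RingHom.snd ℂ[X] ℂ[X]
  ρ := RingHom.snd ℂ[T;T⁻¹] ℂ[T;T⁻¹]
  hα := rfl
  hβ := rfl
  α_surjective := fun f => ⟨nodeOfSnd f, rfl⟩
  β_surjective := Prod.snd_surjective
  ρ_surjective := Prod.snd_surjective
  ev_comp := RingHom.ext fun f => f.2.symm
  x := nodeY
  y := nodeX
  α_x := rfl
  α_y := rfl
  nodeEv_y := by simp [nodeEv, nodeX, lineEv]
  α_t := rfl
  β_t := rfl
  x_mul := fun a ha => nodeRing_ext (zero_mul _)
    (show X * a.1.2 = 0 by rw [show a.1.2 = 0 from ha, mul_zero])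
  ann_x := fun c hc => by
    have h1 : X * c.1.2 = 0 := congrArg (fun z : nodeRing => z.1.2) hc
    have h2 : c.1.2 = 0 := (mul_eq_zero.1 h1).resolve_left X_ne_zero
    obtain ⟨f, hf⟩ := X_dvd_iff.2 (show c.1.1.coeff 0 = 0 by
      rw [coeff_zero_eq_eval_zero, nodeRing_eval_eq, h2, eval_zero])
    exact ⟨nodeOfFst f, nodeRing_ext hf (h2.trans (zero_mul _).symm)⟩
  ε := (0, 1)
  β_ε := rfl
  ε_mul := fun b hb => Prod.ext (zero_mul _)
    (by rw [Prod.snd_mul, show b.2 = 0 from hb, mul_zero]; rfl)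
  δ := (0, 1)
  δ_mul := fun b hb => Prod.ext (zero_mul _)
    (by rw [Prod.snd_mul, show b.2 = 0 from hb, mul_zero]; rfl)
  resV_ε := Prod.ext (map_zero lineResV) (map_one lineResV)
  resU_x := Prod.ext ((map_zero lineResU).trans (zero_mul _).symm) (one_mul _).symm

namespace AngleModule

variable (E : AngleModule) (s : Branch)

/-- The restriction of `E` to a branch. -/
def branch : LineModule := E.pullback lineResU lineResV s.α s.β s.ρ s.hα s.hβ

/-- Restriction of sections over `U` to a branch. -/
def toU : E.onU →ₛₗ[s.α] (E.branch s).onU := BaseChange.mk s.α E.onU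

/-- Restriction of sections over `V` to a branch. -/
def toV : E.onV →ₛₗ[s.β] (E.branch s).onV := BaseChange.mk s.β E.onV

/-- Restriction of sections over `U ∩ V` to a branch. -/
def toUV : E.onUV →ₛₗ[s.ρ] (E.branch s).onUV := BaseChange.mk s.ρ E.onUV

theorem toU_surjective : Function.Surjective (E.toU s) := BaseChange.mk_surjective _ s.α_surjective
theorem toV_surjective : Function.Surjective (E.toV s) := BaseChange.mk_surjective _ s.β_surjective
theorem toUV_surjective : Function.Surjective (E.toUV s) :=
  BaseChange.mk_surjective _ s.ρ_surjective

theorem branch_resU (m : E.onU) : (E.branch s).resU (E.toU s m) = E.toUV s (E.resU m) :=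
  BaseChange.map_mk _ _ _ s.hα _ _

theorem branch_resV (m : E.onV) : (E.branch s).resV (E.toV s m) = E.toUV s (E.resV m) :=
  BaseChange.map_mk _ _ _ s.hβ _ _

variable {E}

theorem smul_eq_zero_of_toUV_eq_zero {q : E.onUV} (h : E.toUV s q = 0) : s.δ • q = 0 :=
  BaseChange.smul_eq_zero_of_mk_eq_zero _ s.ρ_surjective s.δ_mul h

theorem smul_eq_zero_of_toV_eq_zero {n : E.onV} (h : E.toV s n = 0) : s.ε • n = 0 :=
  BaseChange.smul_eq_zero_of_mk_eq_zero _ s.β_surjective s.ε_mul h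

theorem toV_eq_zero_of_smul_eq_zero {n : E.onV} (h : s.ε • n = 0) : E.toV s n = 0 := by
  have := (E.toV s).map_smulₛₗ s.ε n
  rwa [h, map_zero, s.β_ε, one_smul, eq_comm] at this

theorem toU_smul_y (m : E.onU) : E.toU s (s.y • m) = 0 := by
  rw [LinearMap.map_smulₛₗ, s.α_y, zero_smul]

/-- Flatness enters here: a section killed by `x` is a multiple of `y`, and `y` vanishes on the
branch. -/
theorem IsBundle.toU_eq_zero_of_smul_eq_zero (hE : E.IsBundle) {m : E.onU} (h : s.x • m = 0) :
    E.toU s m = 0 := by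
  obtain ⟨m', rfl⟩ := hE.exists_eq_smul s.x s.y s.ann_x m h
  exact toU_smul_y s m'

theorem smul_eq_zero_of_toU_eq_zero {m : E.onU} (h : E.toU s m = 0) : s.x • m = 0 :=
  BaseChange.smul_eq_zero_of_mk_eq_zero _ s.α_surjective s.x_mul h

theorem IsBundle.exists_eq_smul_of_toU_eq_zero (hE : E.IsBundle) {m : E.onU} (h : E.toU s m = 0) :
    ∃ m', m = s.y • m' :=
  hE.exists_eq_smul s.x s.y s.ann_x m (smul_eq_zero_of_toU_eq_zero s h)

theorem IsBundle.branch (hE : E.IsBundle) : LineModule.IsBundle (E.branch s) := by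
  refine ⟨?_, ?_, fun q => ?_, fun q => ?_⟩
  · have := hE.finite_onU
    have : RingHomSurjective s.α := ⟨s.α_surjective⟩
    exact Module.Finite.of_surjective (E.toU s) (E.toU_surjective s)
  · rw [injective_iff_map_eq_zero]
    intro m1 h
    obtain ⟨m, rfl⟩ := E.toU_surjective s m1
    rw [branch_resU] at h
    -- Away from the node, `x` is the idempotent `δ` of the branch times `x + y`, and `δ` kills
    -- whatever restricts to zero on the branch.
    refine hE.toU_eq_zero_of_smul_eq_zero s (hE.resU_injective ?_)
    rw [map_zero, LinearMap.map_smulₛₗ, s.resU_x, mul_comm, mul_smul,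
      smul_eq_zero_of_toUV_eq_zero s h, smul_zero]
  · obtain ⟨q, rfl⟩ := E.toUV_surjective s q
    obtain ⟨n, m, h⟩ := hE.exists_resU q
    refine ⟨n, E.toU s m, ?_⟩
    rw [branch_resU, ← h, LinearMap.map_smulₛₗ, map_pow]
    have h2 : s.ρ (angleResU nodeT) = lineResU X :=
      (RingHom.congr_fun s.hα nodeT).symm.trans (congrArg lineResU s.α_t)
    rw [h2, ← map_pow, lineResU_X_pow]
  · obtain ⟨q, rfl⟩ := E.toUV_surjective s q
    obtain ⟨n, m, h⟩ := hE.exists_resV q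
    refine ⟨n, E.toV s m, ?_⟩
    rw [branch_resV, ← h, LinearMap.map_smulₛₗ, map_pow]
    have h2 : s.ρ (angleResV (X, X)) = lineResV X :=
      (RingHom.congr_fun s.hβ (X, X)).symm.trans (congrArg lineResV s.β_t)
    rw [h2, ← map_pow, lineResV_X_pow]

/-- Cochains on a branch lift to the whole curve, and a decomposition of the lift restricts back. -/
theorem branch_H1Zero {c : (ℂ[T;T⁻¹] × ℂ[T;T⁻¹])ˣ} {c' : ℂ[T;T⁻¹]ˣ} (hc : s.ρ c = c')
    (h : E.H1Zero c) : (E.branch s).H1Zero c' := by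
  intro q
  obtain ⟨q, rfl⟩ := E.toUV_surjective s q
  obtain ⟨m, n, rfl⟩ := h q
  refine ⟨E.toU s m, E.toV s n, ?_⟩
  rw [branch_resU, branch_resV, map_add, LinearMap.map_smulₛₗ, hc]

/-- The coordinate times a section on one branch vanishes at the node, so it extends by zero to the
other branch. The gluing unit loses one power of the coordinate on this branch, and its other
component is arbitrary. Over the charts the extension is `x • m` and `ε • n`, for any lifts `m`,
`n`. -/
theorem IsBundle.branch_H0Zero (hE : E.IsBundle) {c : (ℂ[T;T⁻¹] × ℂ[T;T⁻¹])ˣ} {c' : ℂ[T;T⁻¹]ˣ}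
    (hc : s.ρ c = T 1 * (c' : ℂ[T;T⁻¹])) (h : E.H0Zero c) : (E.branch s).H0Zero c' := by
  intro m1 n1 hmn
  obtain ⟨m, rfl⟩ := E.toU_surjective s m1
  obtain ⟨n, rfl⟩ := E.toV_surjective s n1
  have h2 : s.ρ (angleResU nodeT) = T 1 :=
    (RingHom.congr_fun s.hα nodeT).symm.trans ((congrArg lineResU s.α_t).trans lineResU_X)
  have h3 : E.toUV s (angleResU nodeT • E.resU m - (c : ℂ[T;T⁻¹] × ℂ[T;T⁻¹]) • E.resV n) = 0 := by
    rw [map_sub, LinearMap.map_smulₛₗ, LinearMap.map_smulₛₗ, h2, hc, ← branch_resU, ← branch_resV,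
      hmn, smul_smul, sub_self]
  have h4 := smul_eq_zero_of_toUV_eq_zero s h3
  rw [smul_sub, sub_eq_zero, smul_smul, ← s.resU_x, smul_comm, ← s.resV_ε] at h4
  obtain ⟨h5, h6⟩ := h (s.x • m) (s.ε • n) (by
    rw [LinearMap.map_smulₛₗ, LinearMap.map_smulₛₗ, h4])
  exact ⟨hE.toU_eq_zero_of_smul_eq_zero s h5, toV_eq_zero_of_smul_eq_zero s h6⟩

end AngleModule

/-! ### Gluing splittings of the two restrictions -/

/-- An element is determined by its two images, so common lifts of two bases form a basis as soon as
the two coordinates of every element come from one scalar of `A`. This serves `U`, `V` and `U ∩ V`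
alike; only over `U` is the last condition a real constraint. -/
theorem exists_basis_of_pair {A A₁ A₂ M M₁ M₂ ι : Type} [CommRing A] [CommRing A₁] [CommRing A₂]
    [AddCommGroup M] [AddCommGroup M₁] [AddCommGroup M₂] [Module A M] [Module A₁ M₁] [Module A₂ M₂]
    [Fintype ι] {α₁ : A →+* A₁} {α₂ : A →+* A₂} (f₁ : M →ₛₗ[α₁] M₁) (f₂ : M →ₛₗ[α₂] M₂)
    (hA : ∀ a, α₁ a = 0 → α₂ a = 0 → a = 0) (hM : ∀ m, f₁ m = 0 → f₂ m = 0 → m = 0)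
    (b₁ : Module.Basis ι A₁ M₁) (b₂ : Module.Basis ι A₂ M₂) (u : ι → M) (hu₁ : ∀ i, f₁ (u i) = b₁ i)
    (hu₂ : ∀ i, f₂ (u i) = b₂ i)
    (h : ∀ m i, ∃ a, α₁ a = b₁.repr (f₁ m) i ∧ α₂ a = b₂.repr (f₂ m) i) :
    ∃ b : Module.Basis ι A M, ∀ i, b i = u i := by
  have hli : LinearIndependent A u := by
    rw [Fintype.linearIndependent_iff]
    intro g hg i
    refine hA _ ?_ ?_
    · have := congrArg f₁ hg
      simp only [map_sum, LinearMap.map_smulₛₗ, hu₁, map_zero] at this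
      exact Fintype.linearIndependent_iff.1 b₁.linearIndependent _ this i
    · have := congrArg f₂ hg
      simp only [map_sum, LinearMap.map_smulₛₗ, hu₂, map_zero] at this
      exact Fintype.linearIndependent_iff.1 b₂.linearIndependent _ this i
  have hsp : ⊤ ≤ Submodule.span A (Set.range u) := by
    intro m _
    choose a ha₁ ha₂ using h m
    have hm : m = ∑ i, a i • u i := by
      rw [← sub_eq_zero]
      refine hM _ ?_ ?_
      · simp only [map_sub, map_sum, LinearMap.map_smulₛₗ, hu₁, ha₁, b₁.sum_repr, sub_self]
      · simp only [map_sub, map_sum, LinearMap.map_smulₛₗ, hu₂, ha₂, b₂.sum_repr, sub_self]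
    rw [hm]
    exact sum_mem fun i _ => Submodule.smul_mem _ _ (Submodule.subset_span ⟨i, rfl⟩)
  exact ⟨Module.Basis.mk hli hsp, fun i => Module.Basis.mk_apply hli hsp i⟩

theorem lineEv_surjective : Function.Surjective lineEv := fun c => ⟨C c, by simp [lineEv]⟩

theorem nodeEv_surjective : Function.Surjective nodeEv := fun c => ⟨nodeOfFst (C c), by
  simp [nodeEv, lineEv, nodeOfFst]⟩

theorem nodeEv_eq_zero {a : nodeRing} (ha : nodeEv a = 0) :
    ∃ b c, a = nodeX * b + nodeY * c := by
  have h1 : a.1.1.eval 0 = 0 := ha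
  have h2 : a.1.2.eval 0 = 0 := (nodeRing_eval_eq a).symm.trans h1
  obtain ⟨f, hf⟩ := X_dvd_iff.2 ((coeff_zero_eq_eval_zero _).trans h1)
  obtain ⟨g, hg⟩ := X_dvd_iff.2 ((coeff_zero_eq_eval_zero _).trans h2)
  refine ⟨nodeOfFst f, nodeOfSnd g, nodeRing_ext ?_ ?_⟩
  · change a.1.1 = X * f + 0 * Polynomial.C (g.eval 0)
    rw [hf, zero_mul, add_zero]
  · change a.1.2 = 0 * Polynomial.C (f.eval 0) + X * g
    rw [hg, zero_mul, zero_add]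

/-- Evaluation of sections over `U` at the point `x = 0` of the projective line. -/
def LineModule.toFibre (F : LineModule) : F.onU →ₛₗ[lineEv] F.fibre lineEv :=
  BaseChange.mk lineEv F.onU

theorem LineModule.toFibre_surjective (F : LineModule) : Function.Surjective F.toFibre :=
  BaseChange.mk_surjective _ lineEv_surjective

theorem LineModule.exists_eq_smul_of_toFibre_eq_zero (F : LineModule) {m : F.onU}
    (h : F.toFibre m = 0) : ∃ m', m = (X : ℂ[X]) • m' :=
  BaseChange.exists_eq_smul_of_mk_eq_zero _ lineEv_surjective
    (fun a ha => X_dvd_iff.2 ((coeff_zero_eq_eval_zero a).trans ha)) h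

theorem LineModule.toFibre_smul_X (F : LineModule) (m : F.onU) :
    F.toFibre ((X : ℂ[X]) • m) = 0 := by
  rw [LinearMap.map_smulₛₗ, show lineEv X = 0 from eval_X, zero_smul]

namespace AngleModule

variable (E : AngleModule)

/-- Evaluation of sections over `U` at the node. -/
def toFibre : E.onU →ₛₗ[nodeEv] E.fibre nodeEv := BaseChange.mk nodeEv E.onU

theorem toFibre_surjective : Function.Surjective E.toFibre :=
  BaseChange.mk_surjective _ nodeEv_surjective

variable (s : Branch)

/-- The canonical map from the fibre of `E` at the node to the fibre of its restriction to a
branch. -/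
def toBranchFibre : E.fibre nodeEv →ₗ[ℂ] (E.branch s).fibre lineEv :=
  BaseChange.map nodeEv lineEv (RingHom.id ℂ) (r := s.α) (by rw [s.ev_comp]; rfl) (E.toU s)

theorem toBranchFibre_toFibre (m : E.onU) :
    E.toBranchFibre s (E.toFibre m) = (E.branch s).toFibre (E.toU s m) :=
  BaseChange.map_mk _ _ _ _ _ _

variable {E}

theorem exists_eq_of_toFibre_eq_zero {m : E.onU} (h : E.toFibre m = 0) :
    ∃ u v, m = nodeX • u + nodeY • v := by
  refine Submodule.smul_induction_on (BaseChange.mem_of_mk_eq_zero _ nodeEv_surjective h)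
    (fun a ha n _ => ?_) ?_
  · obtain ⟨b, c, rfl⟩ := nodeEv_eq_zero ha
    exact ⟨b • n, c • n, by rw [add_smul, mul_smul, mul_smul]⟩
  · rintro _ _ ⟨u, v, rfl⟩ ⟨u', v', rfl⟩
    exact ⟨u + u', v + v', by rw [smul_add, smul_add]; abel⟩

/-- For injectivity: if the restriction of a section to the branch vanishes at the node, then after
subtraction of a multiple of `x` it restricts to zero. By flatness the remainder is a multiple of
`y`, and both `x` and `y` vanish at the node. -/
theorem IsBundle.toBranchFibre_bijective (hE : E.IsBundle) :
    Function.Bijective (E.toBranchFibre s) := by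
  constructor
  · rw [injective_iff_map_eq_zero]
    intro k hk
    obtain ⟨m, rfl⟩ := E.toFibre_surjective k
    rw [toBranchFibre_toFibre] at hk
    obtain ⟨m1, h1⟩ := LineModule.exists_eq_smul_of_toFibre_eq_zero _ hk
    obtain ⟨m', rfl⟩ := E.toU_surjective s m1
    have h2 : E.toU s (m - s.x • m') = 0 := by
      rw [map_sub, h1, LinearMap.map_smulₛₗ, s.α_x, sub_self]
    obtain ⟨m'', h3⟩ := hE.exists_eq_smul_of_toU_eq_zero s h2
    have hx : nodeEv s.x = 0 := by
      rw [← s.ev_comp, RingHom.comp_apply, s.α_x]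
      exact eval_X
    rw [sub_eq_iff_eq_add.1 h3, map_add, LinearMap.map_smulₛₗ, LinearMap.map_smulₛₗ, hx,
      s.nodeEv_y, zero_smul, zero_smul, add_zero]
  · intro k
    obtain ⟨m1, rfl⟩ := LineModule.toFibre_surjective _ k
    obtain ⟨m, rfl⟩ := E.toU_surjective s m1
    exact ⟨E.toFibre m, toBranchFibre_toFibre E s m⟩

/-- Sections over `U` are pairs of sections on the branches with the same value at the node. Lifts
of the two differ by some `x u + y v`, and `y v` is invisible on the first branch, `x u` on the
second. -/
theorem IsBundle.exists_toU_eq (hE : E.IsBundle) (k : E.fibre nodeEv)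
    (m₁ : (E.branch .fst).onU) (m₂ : (E.branch .snd).onU)
    (h₁ : E.toBranchFibre .fst k = LineModule.toFibre _ m₁)
    (h₂ : E.toBranchFibre .snd k = LineModule.toFibre _ m₂) :
    ∃ m, E.toU .fst m = m₁ ∧ E.toU .snd m = m₂ := by
  obtain ⟨a, rfl⟩ := E.toU_surjective .fst m₁
  obtain ⟨b, rfl⟩ := E.toU_surjective .snd m₂
  rw [← toBranchFibre_toFibre] at h₁ h₂
  have h1 := (hE.toBranchFibre_bijective _).1 h₁
  have h2 := (hE.toBranchFibre_bijective _).1 h₂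
  obtain ⟨u, v, h⟩ := exists_eq_of_toFibre_eq_zero (E := E) (m := a - b) (by
    rw [map_sub, ← h1, ← h2, sub_self])
  refine ⟨a - nodeY • v, ?_, ?_⟩
  · rw [map_sub, show E.toU .fst (nodeY • v) = 0 from toU_smul_y .fst v, sub_zero]
  · rw [show a - nodeY • v = b + nodeX • u by rw [sub_eq_iff_eq_add.1 h]; abel, map_add,
      show E.toU .snd (nodeX • u) = 0 from toU_smul_y .snd u, add_zero]

theorem exists_toV_eq (n₁ : (E.branch .fst).onV) (n₂ : (E.branch .snd).onV) :
    ∃ n, E.toV .fst n = n₁ ∧ E.toV .snd n = n₂ := by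
  obtain ⟨a, rfl⟩ := E.toV_surjective .fst n₁
  obtain ⟨b, rfl⟩ := E.toV_surjective .snd n₂
  refine ⟨((1, 0) : ℂ[X] × ℂ[X]) • a + ((0, 1) : ℂ[X] × ℂ[X]) • b, ?_, ?_⟩
  · rw [map_add, LinearMap.map_smulₛₗ, LinearMap.map_smulₛₗ]
    rw [show Branch.fst.β (1, 0) = 1 from rfl, show Branch.fst.β (0, 1) = 0 from rfl, one_smul,
      zero_smul, add_zero]
  · rw [map_add, LinearMap.map_smulₛₗ, LinearMap.map_smulₛₗ]
    rw [show Branch.snd.β (1, 0) = 0 from rfl, show Branch.snd.β (0, 1) = 1 from rfl, one_smul,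
      zero_smul, zero_add]

theorem eq_zero_of_toUV_eq_zero {q : E.onUV} (h₁ : E.toUV .fst q = 0) (h₂ : E.toUV .snd q = 0) :
    q = 0 := by
  have h1 := smul_eq_zero_of_toUV_eq_zero .fst h₁
  have h2 := smul_eq_zero_of_toUV_eq_zero .snd h₂
  rw [← one_smul (ℂ[T;T⁻¹] × ℂ[T;T⁻¹]) q,
    show (1 : ℂ[T;T⁻¹] × ℂ[T;T⁻¹]) = Branch.fst.δ + Branch.snd.δ from
      Prod.ext (add_zero 1).symm (zero_add 1).symm,
    add_smul, h1, h2, add_zero]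

theorem eq_zero_of_toV_eq_zero {q : E.onV} (h₁ : E.toV .fst q = 0) (h₂ : E.toV .snd q = 0) :
    q = 0 := by
  have h1 := smul_eq_zero_of_toV_eq_zero .fst h₁
  have h2 := smul_eq_zero_of_toV_eq_zero .snd h₂
  rw [← one_smul (ℂ[X] × ℂ[X]) q,
    show (1 : ℂ[X] × ℂ[X]) = Branch.fst.ε + Branch.snd.ε from
      Prod.ext (add_zero 1).symm (zero_add 1).symm,
    add_smul, h1, h2, add_zero]

theorem IsBundle.eq_zero_of_toU_eq_zero (hE : E.IsBundle) {m : E.onU} (h₁ : E.toU .fst m = 0)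
    (h₂ : E.toU .snd m = 0) : m = 0 := by
  refine hE.resU_injective ((eq_zero_of_toUV_eq_zero ?_ ?_).trans (map_zero _).symm)
  · rw [← branch_resU, h₁, map_zero]
  · rw [← branch_resU, h₂, map_zero]

/-- Frames of the restrictions of `E` to the two branches that agree at the node glue. -/
theorem IsBundle.nonempty_frame (hE : E.IsBundle) {ι : Type} [Fintype ι] {c₁ c₂ : ι → ℂ[T;T⁻¹]ˣ}
    (e₁ : (E.branch .fst).Frame c₁) (e₂ : (E.branch .snd).Frame c₂)
    (v : Module.Basis ι ℂ (E.fibre nodeEv))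
    (h₁ : ∀ i, E.toBranchFibre .fst (v i) = LineModule.toFibre _ (e₁.U i))
    (h₂ : ∀ i, E.toBranchFibre .snd (v i) = LineModule.toFibre _ (e₂.U i)) :
    Nonempty (E.Frame fun i => MulEquiv.prodUnits.symm (c₁ i, c₂ i)) := by
  choose u hu₁ hu₂ using fun i => hE.exists_toU_eq (v i) (e₁.U i) (e₂.U i) (h₁ i) (h₂ i)
  choose w hw₁ hw₂ using fun i => exists_toV_eq (e₁.V i) (e₂.V i)
  obtain ⟨bU, hU⟩ := exists_basis_of_pair (E.toU .fst) (E.toU .snd)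
    (fun a h1 h2 => nodeRing_ext h1 h2) (fun m => hE.eq_zero_of_toU_eq_zero) e₁.U e₂.U u hu₁ hu₂
    (fun m i => by
      -- The coordinates of `m` on either branch reduce at the node to its coordinates in the basis
      -- `v`. Hence the two coordinate polynomials agree at the origin, which is what it takes to be
      -- a function on the node.
      have key₁ : E.toFibre m = ∑ i, lineEv (e₁.U.repr (E.toU .fst m) i) • v i := by
        refine (hE.toBranchFibre_bijective .fst).1 ?_
        rw [toBranchFibre_toFibre, map_sum]
        conv_lhs => rw [← e₁.U.sum_repr (E.toU .fst m)]
        simp only [map_sum, map_smul, LinearMap.map_smulₛₗ, h₁]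
      have key₂ : E.toFibre m = ∑ i, lineEv (e₂.U.repr (E.toU .snd m) i) • v i := by
        refine (hE.toBranchFibre_bijective .snd).1 ?_
        rw [toBranchFibre_toFibre, map_sum]
        conv_lhs => rw [← e₂.U.sum_repr (E.toU .snd m)]
        simp only [map_sum, map_smul, LinearMap.map_smulₛₗ, h₂]
      have key := congrArg (fun k => v.repr k i) (key₁.symm.trans key₂)
      simp only [v.repr_sum_self] at key
      exact ⟨⟨(e₁.U.repr (E.toU .fst m) i, e₂.U.repr (E.toU .snd m) i), key⟩, rfl, rfl⟩)
  obtain ⟨bV, hV⟩ := exists_basis_of_pair (E.toV .fst) (E.toV .snd)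
    (fun a h1 h2 => Prod.ext h1 h2) (fun m => eq_zero_of_toV_eq_zero) e₁.V e₂.V w hw₁ hw₂
    (fun m i => ⟨(e₁.V.repr (E.toV .fst m) i, e₂.V.repr (E.toV .snd m) i), rfl, rfl⟩)
  obtain ⟨bUV, hUV⟩ := exists_basis_of_pair (E.toUV .fst) (E.toUV .snd)
    (fun a h1 h2 => Prod.ext h1 h2) (fun m => eq_zero_of_toUV_eq_zero) e₁.UV e₂.UV
    (fun i => E.resU (u i)) (fun i => by rw [← branch_resU, hu₁, e₁.resU])
    (fun i => by rw [← branch_resU, hu₂, e₂.resU])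
    (fun m i => ⟨(e₁.UV.repr (E.toUV .fst m) i, e₂.UV.repr (E.toUV .snd m) i), rfl, rfl⟩)
  refine ⟨⟨bU, bV, bUV, fun i => by rw [hU, hUV], fun i => ?_⟩⟩
  rw [hV, hUV, ← sub_eq_zero]
  refine eq_zero_of_toUV_eq_zero ?_ ?_
  · rw [map_sub, ← branch_resV, hw₁, LinearMap.map_smulₛₗ, ← branch_resU, hu₁, e₁.resU, e₁.resV]
    exact sub_self _
  · rw [map_sub, ← branch_resV, hw₂, LinearMap.map_smulₛₗ, ← branch_resU, hu₂, e₂.resU, e₂.resV]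
    exact sub_self _

end AngleModule

/-! ### Changing the splitting of a bundle on the projective line -/

theorem exists_basis_of_matrix {A M ι κ : Type} [CommRing A] [AddCommGroup M] [Module A M]
    [Fintype ι] [Fintype κ] [DecidableEq ι] [DecidableEq κ] (b : Module.Basis κ A M)
    (G : Matrix ι κ A) (H : Matrix κ ι A) (hGH : G * H = 1) (hHG : H * G = 1) :
    ∃ b' : Module.Basis ι A M, ∀ i, b' i = ∑ j, G i j • b j := by
  have hli : LinearIndependent A fun i => ∑ j, G i j • b j := by
    rw [Fintype.linearIndependent_iff]
    intro a ha
    simp_rw [Finset.smul_sum, smul_smul] at ha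
    rw [Finset.sum_comm] at ha
    simp_rw [← Finset.sum_smul] at ha
    have h0 : Matrix.vecMul a G = 0 :=
      funext fun j => Fintype.linearIndependent_iff.1 b.linearIndependent _ ha j
    have h1 : Matrix.vecMul (Matrix.vecMul a G) H = 0 := by rw [h0, Matrix.zero_vecMul]
    rw [Matrix.vecMul_vecMul, hGH, Matrix.vecMul_one] at h1
    exact fun i => congrFun h1 i
  have hsp : ⊤ ≤ Submodule.span A (Set.range fun i => ∑ j, G i j • b j) := by
    rw [← b.span_eq, Submodule.span_le]
    rintro _ ⟨j, rfl⟩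
    have hj : b j = ∑ i, H j i • ∑ j, G i j • b j := by
      simp_rw [Finset.smul_sum, smul_smul]
      rw [Finset.sum_comm]
      simp_rw [← Finset.sum_smul, ← Matrix.mul_apply, hHG, Matrix.one_apply, ite_smul, one_smul,
        zero_smul]
      simp
    rw [SetLike.mem_coe, hj]
    exact sum_mem fun i _ => Submodule.smul_mem _ _ (Submodule.subset_span ⟨i, rfl⟩)
  exact ⟨Module.Basis.mk hli hsp, fun i => Module.Basis.mk_apply hli hsp i⟩

theorem exists_basis_of_disjoint {K V : Type} [Field K] [AddCommGroup V] [Module K V]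
    [FiniteDimensional K V] (C₀ C₁ C₂ : Submodule K V) (h₁ : Disjoint C₀ C₁)
    (h₂ : Disjoint (C₀ ⊔ C₁) C₂) (h : C₀ ⊔ C₁ ⊔ C₂ = ⊤) :
    ∃ (a b c : ℕ) (v : Module.Basis ((Fin a ⊕ Fin b) ⊕ Fin c) K V),
      Submodule.span K (Set.range fun i => v (.inl (.inl i))) = C₀ ∧
      Submodule.span K (Set.range fun i => v (.inl (.inr i))) = C₁ ∧
      Submodule.span K (Set.range fun i => v (.inr i)) = C₂ := by
  have key (C : Submodule K V) : ∃ (n : ℕ) (f : Fin n → V), LinearIndependent K f ∧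
      Submodule.span K (Set.range f) = C := by
    let b := Module.finBasis K C
    refine ⟨_, fun i => (b i : V), b.linearIndependent.map' C.subtype (Submodule.ker_subtype C), ?_⟩
    have : (Set.range fun i => (b i : V)) = C.subtype '' Set.range b := by
      rw [← Set.range_comp]
      rfl
    rw [this, Submodule.span_image, b.span_eq, Submodule.map_top, Submodule.range_subtype]
  obtain ⟨a, f₀, hf₀, hs₀⟩ := key C₀
  obtain ⟨b, f₁, hf₁, hs₁⟩ := key C₁
  obtain ⟨c, f₂, hf₂, hs₂⟩ := key C₂
  have hspan : Submodule.span K (Set.range (Sum.elim f₀ f₁)) = C₀ ⊔ C₁ := by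
    rw [Set.Sum.elim_range, Submodule.span_union, hs₀, hs₁]
  have hli : LinearIndependent K (Sum.elim (Sum.elim f₀ f₁) f₂) := by
    refine LinearIndependent.sum_type (LinearIndependent.sum_type hf₀ hf₁ ?_) hf₂ ?_
    · rwa [hs₀, hs₁]
    · rwa [hspan, hs₂]
  have htop : ⊤ ≤ Submodule.span K (Set.range (Sum.elim (Sum.elim f₀ f₁) f₂)) := by
    rw [Set.Sum.elim_range, Submodule.span_union, hspan, hs₂, h]
  refine ⟨a, b, c, Module.Basis.mk hli htop, ?_, ?_, ?_⟩
  · simpa using hs₀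
  · simpa using hs₁
  · simpa using hs₂

namespace LineModule

variable {F : LineModule} {ι κ : Type}

/-- The basis of the fibre at `0` that a frame induces. -/
def fibreBasis {c : κ → ℂ[T;T⁻¹]ˣ} (e : F.Frame c) : Module.Basis κ ℂ (F.fibre lineEv) :=
  BaseChange.basis lineEv e.U

theorem fibreBasis_apply {c : κ → ℂ[T;T⁻¹]ˣ} (e : F.Frame c) (j : κ) :
    fibreBasis e j = F.toFibre (e.U j) :=
  BaseChange.basis_apply _ _ _

/-- The constant matrix `g` of the base change in the fibre is used unchanged over `U`.
Compatibility with the gluing then forces the entry `g i j` to be multiplied over `V` by the power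
`d' j - d i` of the coordinate at infinity. The hypotheses say that this exponent is nonnegative
wherever the entry is nonzero, for `g` and likewise for its inverse. -/
theorem exists_frame_of_fibre_basis [Fintype ι] [Fintype κ] {d' : κ → ℤ}
    (e : F.Frame fun j => unitT (d' j)) {d : ι → ℤ}
    (v : Module.Basis ι ℂ (F.fibre lineEv))
    (hg : ∀ i j, (fibreBasis e).repr (v i) j ≠ 0 → d i ≤ d' j)
    (hh : ∀ i j, v.repr (fibreBasis e j) i ≠ 0 → d' j ≤ d i) :
    ∃ f : F.Frame fun i => unitT (d i), ∀ i, F.toFibre (f.U i) = v i := by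
  classical
  let w := fibreBasis e
  let g : Matrix ι κ ℂ := fun i j => w.repr (v i) j
  let h : Matrix κ ι ℂ := fun j i => v.repr (w j) i
  have hgh : g * h = 1 := by
    ext i i'
    have h1 : v i = ∑ j, g i j • w j := (w.sum_repr (v i)).symm
    have h2 := congrArg (fun z => v.repr z i') h1
    simp only [map_sum, map_smul, Finsupp.coe_finsetSum, Finset.sum_apply, Finsupp.smul_apply,
      smul_eq_mul, Module.Basis.repr_self] at h2
    rw [Matrix.mul_apply, Matrix.one_apply, ← Finsupp.single_apply (a := i) (b := (1 : ℂ))]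
    exact h2.symm
  have hhg : h * g = 1 := by
    ext i i'
    have h1 : w i = ∑ j, h i j • v j := (v.sum_repr (w i)).symm
    have h2 := congrArg (fun z => w.repr z i') h1
    simp only [map_sum, map_smul, Finsupp.coe_finsetSum, Finset.sum_apply, Finsupp.smul_apply,
      smul_eq_mul, Module.Basis.repr_self] at h2
    rw [Matrix.mul_apply, Matrix.one_apply, ← Finsupp.single_apply (a := i) (b := (1 : ℂ))]
    exact h2.symm
  let gU : Matrix ι κ ℂ[X] := g.map Polynomial.C
  let hU : Matrix κ ι ℂ[X] := h.map Polynomial.C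
  let gUV : Matrix ι κ ℂ[T;T⁻¹] := gU.map lineResU
  let hUV : Matrix κ ι ℂ[T;T⁻¹] := hU.map lineResU
  let gV : Matrix ι κ ℂ[X] := fun i j => Polynomial.C (g i j) * X ^ (d' j - d i).toNat
  let hV : Matrix κ ι ℂ[X] := fun j i => Polynomial.C (h j i) * X ^ (d i - d' j).toNat
  have hgV : gV * hV = 1 := by
    ext1 i i'
    -- For a nonzero term `d i ≤ d' j ≤ d i'`, so the exponents add up without truncation and the
    -- total does not depend on `j`.
    have : ∀ j, gV i j * hV j i' = Polynomial.C (g i j * h j i') * X ^ (d i' - d i).toNat := by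
      intro j
      by_cases h1 : g i j = 0
      · simp [gV, h1]
      by_cases h2 : h j i' = 0
      · simp [hV, h2]
      have h3 := hg i j h1
      have h4 := hh i' j h2
      have h5 : (d i' - d i).toNat = (d' j - d i).toNat + (d i' - d' j).toNat := by lia
      simp only [gV, hV, h5, pow_add, Polynomial.C_mul]
      ring
    rw [Matrix.mul_apply, Finset.sum_congr rfl fun j _ => this j, ← Finset.sum_mul, ← map_sum,
      ← Matrix.mul_apply, hgh, Matrix.one_apply, Matrix.one_apply]
    split_ifs with h
    · simp [h]
    · simp
  have hVg : hV * gV = 1 := by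
    ext1 j j'
    have : ∀ i, hV j i * gV i j' = Polynomial.C (h j i * g i j') * X ^ (d' j' - d' j).toNat := by
      intro i
      by_cases h1 : h j i = 0
      · simp [hV, h1]
      by_cases h2 : g i j' = 0
      · simp [gV, h2]
      have h3 := hh i j h1
      have h4 := hg i j' h2
      have h5 : (d' j' - d' j).toNat = (d i - d' j).toNat + (d' j' - d i).toNat := by lia
      simp only [gV, hV, h5, pow_add, Polynomial.C_mul]
      ring
    rw [Matrix.mul_apply, Finset.sum_congr rfl fun j _ => this j, ← Finset.sum_mul, ← map_sum,
      ← Matrix.mul_apply, hhg, Matrix.one_apply, Matrix.one_apply]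
    split_ifs with h
    · simp [h]
    · simp
  have hgU : gU * hU = 1 := by
    rw [← Matrix.map_mul, hgh, Matrix.map_one _ (map_zero _) (map_one _)]
  have hUg : hU * gU = 1 := by
    rw [← Matrix.map_mul, hhg, Matrix.map_one _ (map_zero _) (map_one _)]
  have hgUV : gUV * hUV = 1 := by
    rw [← Matrix.map_mul, hgU, Matrix.map_one _ (map_zero _) (map_one _)]
  have hUVg : hUV * gUV = 1 := by
    rw [← Matrix.map_mul, hUg, Matrix.map_one _ (map_zero _) (map_one _)]
  obtain ⟨bU, hbU⟩ := exists_basis_of_matrix e.U gU hU hgU hUg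
  obtain ⟨bV, hbV⟩ := exists_basis_of_matrix e.V gV hV hgV hVg
  obtain ⟨bUV, hbUV⟩ := exists_basis_of_matrix e.UV gUV hUV hgUV hUVg
  refine ⟨⟨bU, bV, bUV, fun i => ?_, fun i => ?_⟩, fun i => ?_⟩
  · rw [hbU, hbUV, map_sum]
    exact Finset.sum_congr rfl fun j _ => by rw [LinearMap.map_smulₛₗ, e.resU]; rfl
  · rw [hbV, hbUV, map_sum, Finset.smul_sum]
    refine Finset.sum_congr rfl fun j _ => ?_
    rw [LinearMap.map_smulₛₗ, e.resV, smul_smul, smul_smul]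
    congr 1
    by_cases h1 : g i j = 0
    · simp [gV, gUV, gU, h1]
    have h2 := hg i j h1
    change lineResV (Polynomial.C (g i j) * X ^ _) * T (d' j) =
      T (d i) * lineResU (Polynomial.C (g i j))
    rw [map_mul, lineResV_X_pow, mul_assoc, ← T_add, Int.toNat_of_nonneg (by lia), mul_comm]
    congr 1
    · congr 1
      lia
    · simp [lineResV, lineResU]
  · change F.toFibre (bU i) = v i
    rw [hbU, map_sum, ← w.sum_repr (v i)]
    refine Finset.sum_congr rfl fun j _ => ?_
    rw [LinearMap.map_smulₛₗ, fibreBasis_apply]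
    congr 1
    change eval 0 (Polynomial.C (g i j)) = _
    rw [eval_C]

/-- With only two adjacent degrees, the triangularity conditions could fail only where a vector of
degree `k` involves one of degree `k - 1`. Equality of the top degree spans excludes this in both
directions. -/
theorem exists_frame_of_span_eq [Fintype ι] [Fintype κ] {d' : κ → ℤ}
    (e : F.Frame fun j => unitT (d' j)) {d : ι → ℤ}
    {k : ℤ} (hd' : ∀ j, d' j = k ∨ d' j = k - 1) (hd : ∀ i, d i = k ∨ d i = k - 1)
    (v : Module.Basis ι ℂ (F.fibre lineEv))
    (hv : Submodule.span ℂ (v '' {i | d i = k}) =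
      Submodule.span ℂ (fibreBasis e '' {j | d' j = k})) :
    ∃ f : F.Frame fun i => unitT (d i), ∀ i, F.toFibre (f.U i) = v i := by
  refine exists_frame_of_fibre_basis e v (fun i j hij => ?_) (fun i j hij => ?_)
  · rcases hd i with h | h
    · have h1 : v i ∈ Submodule.span ℂ (fibreBasis e '' {j | d' j = k}) := by
        rw [← hv]
        exact Submodule.subset_span ⟨i, h, rfl⟩
      have h2 : d' j = k := (fibreBasis e).mem_span_image.1 h1 (Finsupp.mem_support_iff.2 hij)
      lia
    · rcases hd' j with h' | h' <;> lia
  · rcases hd' j with h | h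
    · have h1 : fibreBasis e j ∈ Submodule.span ℂ (v '' {i | d i = k}) := by
        rw [hv]
        exact Submodule.subset_span ⟨j, h, rfl⟩
      have h2 : d i = k := v.mem_span_image.1 h1 (Finsupp.mem_support_iff.2 hij)
      lia
    · rcases hd i with h' | h' <;> lia

end LineModule

/-! ### Splitting a bundle on the angle by a basis adapted to both positive subspaces -/

/-- The unit `(x ^ a, y ^ b)`. -/
def unitTT (a b : ℤ) : (ℂ[T;T⁻¹] × ℂ[T;T⁻¹])ˣ := MulEquiv.prodUnits.symm (unitT a, unitT b)

namespace AngleModule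

variable {E : AngleModule}

/-- The standard frame of a direct sum of three kinds of line bundles. -/
def sumFrame (a₁ b₁ a₂ b₂ a₃ b₃ : ℤ) (n₁ n₂ n₃ : ℕ) :
    ((((angleO a₁ b₁).copies n₁).sum ((angleO a₂ b₂).copies n₂)).sum
      ((angleO a₃ b₃).copies n₃)).Frame
      (Sum.elim (Sum.elim (fun _ : Fin n₁ => unitTT a₁ b₁) fun _ : Fin n₂ => unitTT a₂ b₂)
        fun _ : Fin n₃ => unitTT a₃ b₃) :=
  ((ChartModule.Frame.copies _ n₁).sum (ChartModule.Frame.copies _ n₂)).sum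
    (ChartModule.Frame.copies _ n₃)

/-- Any basis of the fibre at the node adapted to both top degree subspaces splits `E`: the
splitting on each branch is moved onto this basis, and then the two agree at the node. -/
theorem IsBundle.nonempty_frame_of_span_eq (hE : E.IsBundle) {κ₁ κ₂ ι : Type} [Fintype κ₁]
    [Fintype κ₂] [Fintype ι] {d₁ : κ₁ → ℤ} {d₂ : κ₂ → ℤ} {k l : ℤ}
    (e₁ : (E.branch .fst).Frame fun i => unitT (d₁ i)) (hd₁ : ∀ i, d₁ i = k ∨ d₁ i = k - 1)
    (e₂ : (E.branch .snd).Frame fun i => unitT (d₂ i)) (hd₂ : ∀ i, d₂ i = l ∨ d₂ i = l - 1)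
    {a b : ι → ℤ} (ha : ∀ i, a i = k ∨ a i = k - 1) (hb : ∀ i, b i = l ∨ b i = l - 1)
    (v : Module.Basis ι ℂ (E.fibre nodeEv))
    (h₁ : Submodule.span ℂ (v '' {i | a i = k}) =
      (Submodule.span ℂ (LineModule.fibreBasis e₁ '' {j | d₁ j = k})).comap (E.toBranchFibre .fst))
    (h₂ : Submodule.span ℂ (v '' {i | b i = l}) =
      (Submodule.span ℂ (LineModule.fibreBasis e₂ '' {j | d₂ j = l})).comap
        (E.toBranchFibre .snd)) :
    Nonempty (E.Frame fun i => unitTT (a i) (b i)) := by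
  have key (s : Branch) (S : Set ι) (Q : Submodule ℂ ((E.branch s).fibre lineEv))
      (h : Submodule.span ℂ (v '' S) = Q.comap (E.toBranchFibre s)) :
      Submodule.span ℂ (v.map (LinearEquiv.ofBijective _ (hE.toBranchFibre_bijective s)) '' S) =
        Q := by
    have h1 : v.map (LinearEquiv.ofBijective _ (hE.toBranchFibre_bijective s)) '' S =
        E.toBranchFibre s '' (v '' S) := by
      rw [← Set.image_comp]
      rfl
    rw [h1, Submodule.span_image, h, Submodule.map_comap_eq_of_surjective
      (hE.toBranchFibre_bijective s).2]
  obtain ⟨f₁, hf₁⟩ := LineModule.exists_frame_of_span_eq e₁ hd₁ ha _ (key .fst _ _ h₁)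
  obtain ⟨f₂, hf₂⟩ := LineModule.exists_frame_of_span_eq e₂ hd₂ hb _ (key .snd _ _ h₂)
  exact hE.nonempty_frame f₁ f₂ v (fun i => (hf₁ i).symm) (fun i => (hf₂ i).symm)

/-- Two-step splittings of the restrictions of `E` to the two branches give a splitting of `E`, if
their positive subspaces span the fibre at the node or meet in zero only. -/
theorem IsBundle.almostBalanced (hE : E.IsBundle) {κ₁ κ₂ : Type} [Fintype κ₁] [Fintype κ₂]
    {d₁ : κ₁ → ℤ} {d₂ : κ₂ → ℤ} {k l : ℤ}
    (e₁ : (E.branch .fst).Frame fun i => unitT (d₁ i)) (hd₁ : ∀ i, d₁ i = k ∨ d₁ i = k - 1)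
    (e₂ : (E.branch .snd).Frame fun i => unitT (d₂ i)) (hd₂ : ∀ i, d₂ i = l ∨ d₂ i = l - 1)
    {P₁ P₂ : Submodule ℂ (E.fibre nodeEv)}
    (hP₁ : P₁ = (Submodule.span ℂ (LineModule.fibreBasis e₁ '' {j | d₁ j = k})).comap
      (E.toBranchFibre .fst))
    (hP₂ : P₂ = (Submodule.span ℂ (LineModule.fibreBasis e₂ '' {j | d₂ j = l})).comap
      (E.toBranchFibre .snd))
    (h : P₁ ⊔ P₂ = ⊤ ∨ P₁ ⊓ P₂ = ⊥) : E.AlmostBalanced := by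
  have hfin : FiniteDimensional ℂ (E.fibre nodeEv) :=
    Module.Finite.of_basis ((LineModule.fibreBasis e₁).map
      (LinearEquiv.ofBijective _ (hE.toBranchFibre_bijective .fst)).symm)
  rcases h with h | h
  · left
    -- By the modular law `D ⊓ P₁` and `D ⊓ P₂` complement `P₁ ⊓ P₂` in `P₁` and `P₂`. As `P₁ ⊔ P₂ =
    -- ⊤`, these three pieces exhaust the fibre and give the summands `𝒪(k,l)`, `𝒪(k,l-1)`,
    -- `𝒪(k-1,l)`.
    obtain ⟨D, hD⟩ := Submodule.exists_isCompl (P₁ ⊓ P₂)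
    have hsup {P : Submodule ℂ (E.fibre nodeEv)} (hP : P₁ ⊓ P₂ ≤ P) :
        P₁ ⊓ P₂ ⊔ D ⊓ P = P := by
      rw [← sup_inf_assoc_of_le D hP, hD.sup_eq_top, top_inf_eq]
    obtain ⟨r, s₁, s₂, v, hv₀, hv₁, hv₂⟩ := exists_basis_of_disjoint (P₁ ⊓ P₂) (D ⊓ P₁) (D ⊓ P₂)
      (hD.disjoint.mono_right inf_le_left) (by
        rw [hsup inf_le_left, disjoint_iff, ← hD.inf_eq_bot]
        ac_rfl) (by
        rw [hsup inf_le_left, ← h]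
        refine le_antisymm (sup_le_sup_left inf_le_right _) (sup_le le_sup_left ?_)
        conv_lhs => rw [← hsup (inf_le_right : P₁ ⊓ P₂ ≤ P₂)]
        exact sup_le_sup_right inf_le_left _)
    obtain ⟨f⟩ := hE.nonempty_frame_of_span_eq e₁ hd₁ e₂ hd₂
      (a := Sum.elim (Sum.elim (fun _ => k) fun _ => k) fun _ => k - 1)
      (b := Sum.elim (Sum.elim (fun _ => l) fun _ => l - 1) fun _ => l)
      (by rintro ((i | i) | i) <;> simp) (by rintro ((i | i) | i) <;> simp) v (by
        rw [← hP₁]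
        conv_rhs => rw [← hsup (inf_le_left : P₁ ⊓ P₂ ≤ P₁), ← hv₀, ← hv₁, ← Submodule.span_union]
        congr 1
        ext z
        simp) (by
        rw [← hP₂]
        conv_rhs => rw [← hsup (inf_le_right : P₁ ⊓ P₂ ≤ P₂), ← hv₀, ← hv₂, ← Submodule.span_union]
        congr 1
        ext z
        simp)
    have f' := f.reindex (Equiv.refl _) (d := Sum.elim (Sum.elim (fun _ => unitTT k l)
      fun _ => unitTT k (l - 1)) fun _ => unitTT (k - 1) l) (by rintro ((i | i) | i) <;> rfl)
    exact ⟨k, l, r, s₁, s₂, _, (sumFrame k l k (l - 1) (k - 1) l r s₁ s₂).hom_isIso f'⟩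
  · right
    -- The pieces `P₁`, `P₂`, `D` give `𝒪(k,l-1)`, `𝒪(k-1,l)`, `𝒪(k-1,l-1)`: the second shape, with
    -- `k - 1` and `l - 1` in the place of `k` and `l`.
    obtain ⟨D, hD⟩ := Submodule.exists_isCompl (P₁ ⊔ P₂)
    obtain ⟨r₁, r₂, s, v, hv₀, hv₁, hv₂⟩ := exists_basis_of_disjoint P₁ P₂ D
      (disjoint_iff.2 h) hD.disjoint hD.sup_eq_top
    obtain ⟨f⟩ := hE.nonempty_frame_of_span_eq e₁ hd₁ e₂ hd₂
      (a := Sum.elim (Sum.elim (fun _ => k) fun _ => k - 1) fun _ => k - 1)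
      (b := Sum.elim (Sum.elim (fun _ => l - 1) fun _ => l) fun _ => l - 1)
      (by rintro ((i | i) | i) <;> simp) (by rintro ((i | i) | i) <;> simp) v (by
        rw [← hP₁]
        conv_rhs => rw [← hv₀]
        congr 1
        ext z
        simp) (by
        rw [← hP₂]
        conv_rhs => rw [← hv₁]
        congr 1
        ext z
        simp)
    have f' := f.reindex (Equiv.refl _) (d := Sum.elim
      (Sum.elim (fun _ => unitTT (k - 1 + 1) (l - 1)) fun _ => unitTT (k - 1) (l - 1 + 1)) fun _ => unitTT (k - 1) (l - 1))
      (by rintro ((i | i) | i) <;> simp)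
    exact ⟨k - 1, l - 1, r₁, r₂, s, _, (sumFrame _ _ _ _ _ _ r₁ r₂ s).hom_isIso f'⟩

end AngleModule

/-! ### Splitting a bundle on the projective line by vanishing of cohomology -/

theorem lineResU_injective : Function.Injective lineResU := Polynomial.toLaurent_injective

theorem lineResV_injective : Function.Injective lineResV :=
  (LaurentPolynomial.invert (R := ℂ)).injective.comp Polynomial.toLaurent_injective

theorem lineResV_C (c : ℂ) : lineResV (Polynomial.C c) = lineResU (Polynomial.C c) := by
  simp [lineResV, lineResU]

theorem exists_lineResU_eq {ι : Type} [Fintype ι] (r : ι → ℂ[T;T⁻¹]) :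
    ∃ (N : ℕ) (p : ι → ℂ[X]), ∀ i, T N * r i = lineResU (p i) := by
  choose n f hf using fun i => LaurentPolynomial.exists_T_pow (r i)
  refine ⟨∑ i, n i, fun i => f i * X ^ (∑ j, n j - n i), fun i => ?_⟩
  have hi : n i ≤ ∑ j, n j := Finset.single_le_sum (fun _ _ => Nat.zero_le _) (Finset.mem_univ i)
  rw [map_mul, lineResU_X_pow, show lineResU (f i) = r i * T (n i) from hf i, mul_assoc, ← T_add,
    mul_comm]
  congr 2
  lia

namespace LineModule

variable {F : LineModule}

theorem T_smul_injective (k : ℤ) : Function.Injective fun q : F.onUV => (T k : ℂ[T;T⁻¹]) • q := by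
  intro q q' h
  have h1 := congrArg (fun q : F.onUV => (T (-k) : ℂ[T;T⁻¹]) • q) h
  simpa only [smul_smul, ← T_add, neg_add_cancel, T_zero, one_smul] using h1

theorem resU_smul_X_pow (j : ℕ) (m : F.onU) :
    F.resU ((X ^ j : ℂ[X]) • m) = (T j : ℂ[T;T⁻¹]) • F.resU m := by
  rw [LinearMap.map_smulₛₗ, lineResU_X_pow]

theorem resV_smul_X_pow (j : ℕ) (n : F.onV) :
    F.resV ((X ^ j : ℂ[X]) • n) = (T (-j) : ℂ[T;T⁻¹]) • F.resV n := by
  rw [LinearMap.map_smulₛₗ, lineResV_X_pow]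

theorem resU_smul_X (m : F.onU) : F.resU ((X : ℂ[X]) • m) = (T 1 : ℂ[T;T⁻¹]) • F.resU m := by
  rw [LinearMap.map_smulₛₗ, lineResU_X]

theorem resV_smul_X (n : F.onV) :
    F.resV ((X : ℂ[X]) • n) = (T (-1) : ℂ[T;T⁻¹]) • F.resV n := by
  rw [LinearMap.map_smulₛₗ, lineResV_X]

/-- Families of sections over the two charts that generate all sections, correspond to each other
up to powers of the coordinate, and induce a basis of a fibre form a frame. -/
theorem IsBundle.exists_frame_of_span (hF : F.IsBundle) {κ : Type} [Fintype κ] {d : κ → ℤ}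
    (u : κ → F.onU) (n : κ → F.onV)
    (hun : ∀ i, F.resV (n i) = (T (d i) : ℂ[T;T⁻¹]) • F.resU (u i))
    (hv : LinearIndependent ℂ fun i => F.toFibre (u i))
    (hU : ⊤ ≤ Submodule.span ℂ[X] (Set.range u)) (hV : ⊤ ≤ Submodule.span ℂ[X] (Set.range n)) :
    ∃ e : F.Frame fun i => unitT (d i), ∀ i, e.U i = u i := by
  -- Evaluation of a relation at `0` shows that its coefficients are divisible by `X`; the relation
  -- can be divided by `X`, since multiplication by `X` is injective on sections. Iteration gives
  -- divisibility by every power of `X`.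
  have hdvd (N : ℕ) : ∀ p : κ → ℂ[X], ∑ i, p i • u i = 0 → ∀ i, X ^ N ∣ p i := by
    induction N with
    | zero => simp
    | succ N ih =>
      intro p hp
      have h0 := congrArg F.toFibre hp
      simp only [map_sum, LinearMap.map_smulₛₗ, map_zero] at h0
      have h1 (i : κ) : X ∣ p i := X_dvd_iff.2 ((coeff_zero_eq_eval_zero _).trans
        (Fintype.linearIndependent_iff.1 hv _ h0 i))
      choose q hq using h1
      have h2 : ∑ i, q i • u i = 0 := by
        refine hF.resU_injective (T_smul_injective 1 ?_)
        change (T 1 : ℂ[T;T⁻¹]) • F.resU _ = (T 1 : ℂ[T;T⁻¹]) • F.resU _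
        rw [map_zero, smul_zero, ← resU_smul_X, Finset.smul_sum]
        simp_rw [smul_smul, ← hq, hp, map_zero]
      intro i
      rw [hq, pow_succ']
      exact mul_dvd_mul_left X (ih q h2 i)
  have hliU : LinearIndependent ℂ[X] u := by
    rw [Fintype.linearIndependent_iff]
    intro p hp i
    ext j
    exact X_pow_dvd_iff.1 (hdvd (j + 1) p hp i) j (Nat.lt_succ_self j)
  have hliUV : LinearIndependent ℂ[T;T⁻¹] fun i => F.resU (u i) := by
    rw [Fintype.linearIndependent_iff]
    intro r hr i
    obtain ⟨N, p, hp⟩ := exists_lineResU_eq r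
    have h0 : ∑ i, p i • u i = 0 := by
      refine hF.resU_injective ?_
      rw [map_sum, map_zero]
      simp_rw [LinearMap.map_smulₛₗ, ← hp, mul_smul]
      rw [← Finset.smul_sum, hr, smul_zero]
    have h1 := hp i
    rw [Fintype.linearIndependent_iff.1 hliU p h0 i, map_zero] at h1
    exact (isUnit_T (N : ℤ)).mul_right_eq_zero.1 h1
  have hspUV : ⊤ ≤ Submodule.span ℂ[T;T⁻¹] (Set.range fun i => F.resU (u i)) := by
    intro q _
    obtain ⟨N, m, hm⟩ := hF.exists_resU q
    obtain ⟨p, rfl⟩ := (Submodule.mem_span_range_iff_exists_fun _).1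
      (hU (Submodule.mem_top (x := m)))
    have h1 : q = (T (-N) : ℂ[T;T⁻¹]) • F.resU (∑ i, p i • u i) := by
      rw [← hm, smul_smul, ← T_add, neg_add_cancel, T_zero, one_smul]
    rw [h1, map_sum]
    refine Submodule.smul_mem _ _ (sum_mem fun i _ => ?_)
    rw [LinearMap.map_smulₛₗ]
    exact Submodule.smul_mem _ _ (Submodule.subset_span ⟨i, rfl⟩)
  have hliV : LinearIndependent ℂ[X] n := by
    rw [Fintype.linearIndependent_iff]
    intro p hp i
    have h0 := congrArg F.resV hp
    simp only [map_sum, LinearMap.map_smulₛₗ, hun, smul_smul, map_zero] at h0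
    have h1 := Fintype.linearIndependent_iff.1 hliUV _ h0 i
    exact lineResV_injective (((isUnit_T (d i)).mul_left_eq_zero.1 h1).trans (map_zero _).symm)
  exact ⟨⟨Module.Basis.mk hliU hU, Module.Basis.mk hliV hV, Module.Basis.mk hliUV hspUV,
    fun i => by simp, fun i => by
      rw [Module.Basis.mk_apply, Module.Basis.mk_apply, hun]; rfl⟩, fun i => by simp⟩

/-- The values at `0` of the global sections of the twist of `F` by `a`. -/
def sectionValues (F : LineModule) (a : ℤ) : Submodule ℂ (F.fibre lineEv) where
  carrier := {x | ∃ m n, F.resU m = (T a : ℂ[T;T⁻¹]) • F.resV n ∧ F.toFibre m = x}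
  add_mem' := by
    rintro _ _ ⟨m, n, h, rfl⟩ ⟨m', n', h', rfl⟩
    exact ⟨m + m', n + n', by rw [map_add, map_add, h, h', smul_add], map_add _ _ _⟩
  zero_mem' := ⟨0, 0, by rw [map_zero, map_zero, smul_zero], map_zero _⟩
  smul_mem' := by
    rintro c _ ⟨m, n, h, rfl⟩
    refine ⟨Polynomial.C c • m, Polynomial.C c • n, ?_, ?_⟩
    · rw [LinearMap.map_smulₛₗ, LinearMap.map_smulₛₗ, h, lineResV_C, smul_comm]
    · rw [LinearMap.map_smulₛₗ, show lineEv (Polynomial.C c) = c from eval_C]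

/-- This is the exact sequence `0 → F(a) → F(a + 1) → F(0) → 0`, with `F(0)` the fibre at `0`:
splitting the cochain `x⁻¹ m` corrects `m` by a multiple of `x` to a global section of `F(a + 1)`.
-/
theorem mem_sectionValues_add_one {a : ℤ} (h1 : F.H1Zero (unitT a)) (x : F.fibre lineEv) :
    x ∈ F.sectionValues (a + 1) := by
  obtain ⟨m, rfl⟩ := F.toFibre_surjective x
  obtain ⟨m1, n1, h⟩ := h1 ((T (-1) : ℂ[T;T⁻¹]) • F.resU m)
  refine ⟨m - (X : ℂ[X]) • m1, n1, ?_, by rw [map_sub, toFibre_smul_X, sub_zero]⟩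
  have h2 := congrArg (fun q : F.onUV => (T 1 : ℂ[T;T⁻¹]) • q) h
  change _ = (T 1 : ℂ[T;T⁻¹]) • (_ + (T a : ℂ[T;T⁻¹]) • _) at h2
  simp only [smul_smul, smul_add, ← T_add, add_neg_cancel, T_zero, one_smul] at h2
  rw [map_sub, resU_smul_X, sub_eq_iff_eq_add', h2, add_comm 1 a]

section Generation

variable {κ : Type} [Fintype κ] {d : κ → ℤ} {a : ℤ} {u : κ → F.onU} {n : κ → F.onV}

/-- A global section of `F(a)` is a constant combination of the generators of degree `-a`: after
subtraction of the combination with the same value at `0`, the difference is `x` times a section of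
`F(a - 1)`, hence zero. -/
theorem mem_span_of_resU_eq (h0 : F.H0Zero (unitT (a - 1)))
    (hun : ∀ i, F.resV (n i) = (T (d i) : ℂ[T;T⁻¹]) • F.resU (u i))
    (v : Module.Basis κ ℂ (F.fibre lineEv)) (huv : ∀ i, F.toFibre (u i) = v i)
    (hv : F.sectionValues a = Submodule.span ℂ (v '' {i | d i = -a}))
    {m : F.onU} {l : F.onV} (hml : F.resU m = (T a : ℂ[T;T⁻¹]) • F.resV l) :
    m ∈ Submodule.span ℂ[X] (Set.range u) ∧ l ∈ Submodule.span ℂ[X] (Set.range n) := by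
  have hm : F.toFibre m ∈ Submodule.span ℂ (v '' {i | d i = -a}) := hv ▸ ⟨m, l, hml, rfl⟩
  let c := v.repr (F.toFibre m)
  have hc (i : κ) (hi : c i ≠ 0) : d i = -a := v.mem_span_image.1 hm (Finsupp.mem_support_iff.2 hi)
  obtain ⟨m', hm'⟩ := F.exists_eq_smul_of_toFibre_eq_zero
    (m := m - ∑ i, Polynomial.C (c i) • u i) (by
      rw [map_sub, map_sum, sub_eq_zero]
      simp_rw [LinearMap.map_smulₛₗ, huv,
        show ∀ c, lineEv (Polynomial.C c) = c from fun c => eval_C]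
      exact (v.sum_repr _).symm)
  have key : F.resU (∑ i, Polynomial.C (c i) • u i) =
      (T a : ℂ[T;T⁻¹]) • F.resV (∑ i, Polynomial.C (c i) • n i) := by
    rw [map_sum, map_sum, Finset.smul_sum]
    refine Finset.sum_congr rfl fun i _ => ?_
    rw [LinearMap.map_smulₛₗ, LinearMap.map_smulₛₗ, hun]
    by_cases hi : c i = 0
    · simp [hi]
    · rw [hc i hi, smul_comm (T a : ℂ[T;T⁻¹]), smul_smul (T a : ℂ[T;T⁻¹]), ← T_add, lineResV_C,
        add_neg_cancel, T_zero, one_smul]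
  obtain ⟨h1, h2⟩ := h0 m' (l - ∑ i, Polynomial.C (c i) • n i) (by
    refine T_smul_injective 1 ?_
    change (T 1 : ℂ[T;T⁻¹]) • F.resU m' = (T 1 : ℂ[T;T⁻¹]) • (T (a - 1) : ℂ[T;T⁻¹]) • F.resV _
    rw [← resU_smul_X, ← hm', smul_smul, ← T_add, add_sub_cancel, map_sub, map_sub, hml, key,
      smul_sub])
  rw [h1, smul_zero, sub_eq_zero] at hm'
  rw [sub_eq_zero] at h2
  rw [hm', h2]
  exact ⟨sum_mem fun i _ => Submodule.smul_mem _ _ (Submodule.subset_span ⟨i, rfl⟩),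
    sum_mem fun i _ => Submodule.smul_mem _ _ (Submodule.subset_span ⟨i, rfl⟩)⟩

/-- One degree higher, the same subtraction leaves `x` times a section of `F(a)`, to which
`mem_span_of_resU_eq` applies. -/
theorem mem_span_of_resU_eq_add_one (h0 : F.H0Zero (unitT (a - 1)))
    (hd : ∀ i, d i = -a ∨ d i = -a - 1)
    (hun : ∀ i, F.resV (n i) = (T (d i) : ℂ[T;T⁻¹]) • F.resU (u i))
    (v : Module.Basis κ ℂ (F.fibre lineEv)) (huv : ∀ i, F.toFibre (u i) = v i)
    (hv : F.sectionValues a = Submodule.span ℂ (v '' {i | d i = -a}))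
    {m : F.onU} {l : F.onV} (hml : F.resU m = (T (a + 1) : ℂ[T;T⁻¹]) • F.resV l) :
    m ∈ Submodule.span ℂ[X] (Set.range u) ∧ l ∈ Submodule.span ℂ[X] (Set.range n) := by
  let c := v.repr (F.toFibre m)
  obtain ⟨m', hm'⟩ := F.exists_eq_smul_of_toFibre_eq_zero
    (m := m - ∑ i, Polynomial.C (c i) • u i) (by
      rw [map_sub, map_sum, sub_eq_zero]
      simp_rw [LinearMap.map_smulₛₗ, huv,
        show ∀ c, lineEv (Polynomial.C c) = c from fun c => eval_C]
      exact (v.sum_repr _).symm)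
  -- The exponent is `1` in degree `-a` and `0` in degree `-a - 1`; it turns each generator into a
  -- global section of `F(a + 1)`.
  let g (i : κ) : ℂ[X] := Polynomial.C (c i) * X ^ (a + 1 + d i).toNat
  have key : F.resU (∑ i, Polynomial.C (c i) • u i) =
      (T (a + 1) : ℂ[T;T⁻¹]) • F.resV (∑ i, g i • n i) := by
    rw [map_sum, map_sum, Finset.smul_sum]
    refine Finset.sum_congr rfl fun i _ => ?_
    have hi := hd i
    rw [LinearMap.map_smulₛₗ, LinearMap.map_smulₛₗ, hun, map_mul, lineResV_X_pow, lineResV_C,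
      smul_smul, smul_smul, mul_left_comm, mul_assoc, mul_assoc, ← T_add, ← T_add,
      show a + 1 + (-((a + 1 + d i).toNat : ℤ) + d i) = 0 by lia, T_zero, mul_one]
  obtain ⟨h1, h2⟩ := mem_span_of_resU_eq h0 hun v huv hv (m := m') (l := l - ∑ i, g i • n i) (by
    refine T_smul_injective 1 ?_
    change (T 1 : ℂ[T;T⁻¹]) • F.resU m' = (T 1 : ℂ[T;T⁻¹]) • (T a : ℂ[T;T⁻¹]) • F.resV _
    rw [← resU_smul_X, ← hm', smul_smul, ← T_add, add_comm 1 a, map_sub, map_sub, hml, key,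
      smul_sub])
  rw [sub_eq_iff_eq_add] at hm'
  constructor
  · rw [hm']
    exact add_mem (Submodule.smul_mem _ _ h1)
      (sum_mem fun i _ => Submodule.smul_mem _ _ (Submodule.subset_span ⟨i, rfl⟩))
  · rw [← sub_add_cancel l (∑ i, g i • n i)]
    exact add_mem h2 (sum_mem fun i _ => Submodule.smul_mem _ _ (Submodule.subset_span ⟨i, rfl⟩))

end Generation

/-- A vector bundle on the projective line with `H¹(F(a)) = H⁰(F(a - 1)) = 0` splits into copies of
`𝒪(-a)` and `𝒪(-a - 1)`, and the former are generated by the global sections of `F(a)`. -/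
theorem IsBundle.exists_frame (hF : F.IsBundle) {a : ℤ} (h1 : F.H1Zero (unitT a))
    (h0 : F.H0Zero (unitT (a - 1))) :
    ∃ (κ : Type) (_ : Fintype κ) (d : κ → ℤ) (e : F.Frame fun i => unitT (d i)),
      (∀ i, d i = -a ∨ d i = -a - 1) ∧
      Submodule.span ℂ (fibreBasis e '' {i | d i = -a}) = F.sectionValues a := by
  have hfin : FiniteDimensional ℂ (F.fibre lineEv) := by
    have := hF.finite_onU
    have : RingHomSurjective lineEv := ⟨lineEv_surjective⟩
    exact Module.Finite.of_surjective F.toFibre F.toFibre_surjective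
  obtain ⟨D, hD⟩ := Submodule.exists_isCompl (F.sectionValues a)
  -- The third subspace is `⊥`, so the block `Fin t` is empty and its degree below is a dummy value.
  obtain ⟨r, s, t, v, hr, -, -⟩ := exists_basis_of_disjoint (F.sectionValues a) D ⊥ hD.disjoint
    disjoint_bot_right (by rw [sup_bot_eq, hD.sup_eq_top])
  let d : (Fin r ⊕ Fin s) ⊕ Fin t → ℤ :=
    Sum.elim (Sum.elim (fun _ => -a) fun _ => -a - 1) fun _ => -a - 1
  have hd (i) : d i = -a ∨ d i = -a - 1 := by rcases i with (i | i) | i <;> simp [d]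
  have hv : F.sectionValues a = Submodule.span ℂ (v '' {i | d i = -a}) := by
    rw [← hr]
    congr 1
    ext z
    simp [d]
  -- Basis vectors of degree `-a` are values of sections of `F(a)` by choice; the others are values
  -- of sections of `F(a + 1)`, because `H¹(F(a))` vanishes.
  have hex (i) : ∃ m n, F.resV n = (T (d i) : ℂ[T;T⁻¹]) • F.resU m ∧ F.toFibre m = v i := by
    have h2 : v i ∈ F.sectionValues (-d i) := by
      rcases hd i with h | h
      · rw [h, neg_neg, hv]
        exact Submodule.subset_span ⟨i, h, rfl⟩
      · rw [h, show -(-a - 1) = a + 1 by ring]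
        exact mem_sectionValues_add_one h1 _
    obtain ⟨m, n, hmn, hm⟩ := h2
    refine ⟨m, n, ?_, hm⟩
    rw [hmn, smul_smul, ← T_add, add_neg_cancel, T_zero, one_smul]
  choose u n hun huv using hex
  have hgen {m : F.onU} {l : F.onV} (hml : F.resU m = (T (a + 1) : ℂ[T;T⁻¹]) • F.resV l) :=
    mem_span_of_resU_eq_add_one h0 hd hun v huv hv hml
  -- A Castelnuovo–Mumford induction: splitting a cochain by `H¹(F(a)) = 0` writes a section of `F(a
  -- + j + 1)`, seen over `U`, as `x ^ j` times a section of `F(a + 1)` plus a section of `F(a +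
  -- j)`.
  have hU (j : ℕ) : ∀ (m : F.onU) (l : F.onV), F.resU m = (T (a + j) : ℂ[T;T⁻¹]) • F.resV l →
      m ∈ Submodule.span ℂ[X] (Set.range u) := by
    induction j with
    | zero =>
      intro m l hml
      exact (mem_span_of_resU_eq h0 hun v huv hv (l := l) (by simpa using hml)).1
    | succ j ih =>
      intro m l hml
      obtain ⟨m1, n1, h⟩ := h1 ((T (a + 1) : ℂ[T;T⁻¹]) • F.resV l)
      change _ = _ + (T a : ℂ[T;T⁻¹]) • _ at h
      have h2 := (hgen (m := m1) (l := l - (X : ℂ[X]) • n1) (by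
        rw [map_sub, resV_smul_X, smul_sub, h, smul_smul, ← T_add, add_neg_cancel_right,
          add_sub_cancel_right])).1
      have h3 := ih (m - (X ^ j : ℂ[X]) • m1) n1 (by
        rw [map_sub, resU_smul_X_pow, hml, ← sub_eq_iff_eq_add.2 h, smul_sub, smul_smul, smul_smul,
          ← T_add, ← T_add]
        rw [show (a + ((j + 1 : ℕ) : ℤ)) = j + (a + 1) by push_cast; ring, add_comm a (j : ℤ)]
        abel)
      rw [← sub_add_cancel m ((X ^ j : ℂ[X]) • m1)]
      exact add_mem h3 (Submodule.smul_mem _ _ h2)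
  -- The mirror image over `V`, with the coordinate at infinity in the place of `x`.
  have hV (j : ℕ) : ∀ (m : F.onU) (l : F.onV), F.resU m = (T (a + j) : ℂ[T;T⁻¹]) • F.resV l →
      l ∈ Submodule.span ℂ[X] (Set.range n) := by
    induction j with
    | zero =>
      intro m l hml
      exact (mem_span_of_resU_eq h0 hun v huv hv (m := m) (by simpa using hml)).2
    | succ j ih =>
      intro m l hml
      obtain ⟨m1, n1, h⟩ := h1 ((T (-1) : ℂ[T;T⁻¹]) • F.resU m)
      change _ = _ + (T a : ℂ[T;T⁻¹]) • _ at h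
      have h2 := (hgen (m := m - (X : ℂ[X]) • m1) (l := n1) (by
        have h4 := congrArg (fun q : F.onUV => (T 1 : ℂ[T;T⁻¹]) • q) h
        simp only [smul_smul, smul_add, ← T_add, add_neg_cancel, T_zero, one_smul] at h4
        rw [map_sub, resU_smul_X, h4, add_comm a 1, add_sub_cancel_left])).2
      have h3 := ih m1 (l - (X ^ j : ℂ[X]) • n1) (by
        rw [map_sub, resV_smul_X_pow, ← sub_eq_iff_eq_add.2 h, hml, smul_sub, smul_smul, smul_smul,
          ← T_add, ← T_add, add_neg_cancel_right]
        congr 3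
        push_cast
        ring)
      rw [← sub_add_cancel l ((X ^ j : ℂ[X]) • n1)]
      exact add_mem h3 (Submodule.smul_mem _ _ h2)
  obtain ⟨e, he⟩ := hF.exists_frame_of_span u n hun (by
      simp_rw [huv]
      exact v.linearIndependent) (fun m _ => by
      -- A section over `U` has a pole of some order at most `N` at infinity, so it extends to a
      -- global section of `F(a + j)` once `a + j ≥ N`. The same holds below for sections over `V`,
      -- with their poles at `0`.
      obtain ⟨N, l, hl⟩ := hF.exists_resV (F.resU m)
      refine hU (N - a).toNat m ((X ^ (a + (N - a).toNat - N).toNat : ℂ[X]) • l) ?_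
      rw [resV_smul_X_pow, ← hl, smul_smul, smul_smul, ← T_add, ← T_add,
        show a + ((N - a).toNat : ℤ) + -((a + (N - a).toNat - N).toNat : ℤ) + -(N : ℤ) = 0 by lia,
        T_zero, one_smul]) (fun l _ => by
      obtain ⟨N, m, hm⟩ := hF.exists_resU (F.resV l)
      refine hV (N - a).toNat ((X ^ (a + (N - a).toNat - N).toNat : ℂ[X]) • m) l ?_
      rw [resU_smul_X_pow, ← hm, smul_smul, ← T_add]
      congr 2
      lia)
  refine ⟨_, inferInstance, d, e, hd, ?_⟩
  rw [hv]
  congr 1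
  refine Set.image_congr fun i _ => ?_
  rw [fibreBasis_apply, he, huv]

end LineModule

/-! ### Vanishing of cohomology implies almost balanced -/

theorem unitTT_mul (a b c d : ℤ) : unitTT a b * unitTT c d = unitTT (a + c) (b + d) :=
  Units.ext (Prod.ext (T_add a c).symm (T_add b d).symm)

namespace AngleModule

variable {E : AngleModule}

theorem subsingleton_twist_H0_iff {a b : ℤ} :
    Subsingleton (E.twist a b).H0 ↔ E.H0Zero (unitTT a b) := by
  rw [ChartModule.subsingleton_H0_iff]
  refine (ChartModule.tensor_H0Zero_iff E (unitTT a b) 1).trans ?_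
  rw [one_mul]

theorem subsingleton_twist_H1_iff {a b : ℤ} :
    Subsingleton (E.twist a b).H1 ↔ E.H1Zero (unitTT a b) := by
  rw [ChartModule.subsingleton_H1_iff]
  refine (ChartModule.tensor_H1Zero_iff E (unitTT a b) 1).trans ?_
  rw [one_mul]

theorem twist_H0Zero_iff {a b c d : ℤ} :
    (E.twist a b).H0Zero (unitTT c d) ↔ E.H0Zero (unitTT (c + a) (d + b)) := by
  refine (ChartModule.tensor_H0Zero_iff E (unitTT a b) _).trans ?_
  rw [unitTT_mul]

theorem twist_H1Zero_iff {a b c d : ℤ} :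
    (E.twist a b).H1Zero (unitTT c d) ↔ E.H1Zero (unitTT (c + a) (d + b)) := by
  refine (ChartModule.tensor_H1Zero_iff E (unitTT a b) _).trans ?_
  rw [unitTT_mul]

theorem twistVanishing_iff : E.TwistVanishing ↔ ∃ a b : ℤ,
    (E.H1Zero (unitTT a b) ∧ E.H0Zero (unitTT (a - 1) b) ∧ E.H0Zero (unitTT a (b - 1))) ∨
    (E.H0Zero (unitTT a b) ∧ E.H1Zero (unitTT (a + 1) b) ∧ E.H1Zero (unitTT a (b + 1))) := by
  have key (a b : ℤ) :
      ((Subsingleton (E.twist a b).H1 ∧ Subsingleton ((E.twist a b).twist (-1) 0).H0 ∧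
          Subsingleton ((E.twist a b).twist 0 (-1)).H0) ∨
        (Subsingleton (E.twist a b).H0 ∧ Subsingleton ((E.twist a b).twist 1 0).H1 ∧
          Subsingleton ((E.twist a b).twist 0 1).H1)) ↔
      (E.H1Zero (unitTT a b) ∧ E.H0Zero (unitTT (a - 1) b) ∧ E.H0Zero (unitTT a (b - 1))) ∨
      (E.H0Zero (unitTT a b) ∧ E.H1Zero (unitTT (a + 1) b) ∧ E.H1Zero (unitTT a (b + 1))) := by
    simp only [subsingleton_twist_H0_iff, subsingleton_twist_H1_iff, twist_H0Zero_iff,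
      twist_H1Zero_iff, zero_add, neg_add_eq_sub, add_comm (1 : ℤ)]
  constructor
  · rintro ⟨k, l, _, rfl, h⟩
    exact ⟨-k, -l, (key _ _).1 h⟩
  · rintro ⟨a, b, h⟩
    refine ⟨-a, -b, _, rfl, ?_⟩
    rw [neg_neg, neg_neg]
    exact (key a b).2 h

/-- The cochain that is `m` on the first branch and zero on the second is decomposed by `H¹ = 0`
with a section `m'` over `U`. Then `m - m'` extends to a global section on the first branch and `m'`
to one on the second, and their values at the node add up to that of `m`. -/
theorem sup_sectionValues_eq_top {a b : ℤ} (h : E.H1Zero (unitTT a b)) :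
    ((E.branch .fst).sectionValues a).comap (E.toBranchFibre .fst) ⊔
      ((E.branch .snd).sectionValues b).comap (E.toBranchFibre .snd) = ⊤ := by
  rw [eq_top_iff]
  intro x _
  obtain ⟨m, rfl⟩ := E.toFibre_surjective x
  obtain ⟨m', n', h'⟩ := h (Branch.fst.δ • E.resU m)
  have h₁ := congrArg (E.toUV .fst) h'
  have h₂ := congrArg (E.toUV .snd) h'
  rw [LinearMap.map_smulₛₗ, map_add, LinearMap.map_smulₛₗ, ← branch_resU, ← branch_resU,
    ← branch_resV] at h₁ h₂
  change (1 : ℂ[T;T⁻¹]) • _ = _ + (T a : ℂ[T;T⁻¹]) • _ at h₁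
  change (0 : ℂ[T;T⁻¹]) • _ = _ + (T b : ℂ[T;T⁻¹]) • _ at h₂
  rw [one_smul] at h₁
  rw [zero_smul, eq_comm, add_eq_zero_iff_eq_neg] at h₂
  rw [← sub_add_cancel (E.toFibre m) (E.toFibre m')]
  refine Submodule.add_mem_sup ?_ ?_
  · rw [Submodule.mem_comap, map_sub, toBranchFibre_toFibre, toBranchFibre_toFibre]
    exact ⟨_, E.toV .fst n', by rw [map_sub, h₁, add_sub_cancel_left], map_sub _ _ _⟩
  · rw [Submodule.mem_comap, toBranchFibre_toFibre]
    exact ⟨_, -E.toV .snd n', by rw [h₂, map_neg, smul_neg], rfl⟩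

/-- Global sections on the two branches with a common value at the node glue to a global section of
the twist, which is zero. -/
theorem IsBundle.inf_sectionValues_eq_bot (hE : E.IsBundle) {a b : ℤ} (h : E.H0Zero (unitTT a b)) :
    ((E.branch .fst).sectionValues a).comap (E.toBranchFibre .fst) ⊓
      ((E.branch .snd).sectionValues b).comap (E.toBranchFibre .snd) = ⊥ := by
  rw [eq_bot_iff]
  rintro x ⟨⟨m₁, n₁, h₁, hm₁⟩, ⟨m₂, n₂, h₂, hm₂⟩⟩
  obtain ⟨m, rfl, rfl⟩ := hE.exists_toU_eq x m₁ m₂ hm₁.symm hm₂.symm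
  obtain ⟨n, rfl, rfl⟩ := exists_toV_eq n₁ n₂
  obtain ⟨h0, -⟩ := h m n (by
    rw [← sub_eq_zero]
    refine eq_zero_of_toUV_eq_zero ?_ ?_
    · rw [map_sub, LinearMap.map_smulₛₗ, ← branch_resU, ← branch_resV, h₁]
      exact sub_self _
    · rw [map_sub, LinearMap.map_smulₛₗ, ← branch_resU, ← branch_resV, h₂]
      exact sub_self _)
  refine (hE.toBranchFibre_bijective .fst).1 ?_
  rw [← hm₁, h0, map_zero, map_zero, map_zero]

/-- Both alternatives impose the same conditions on the branches, `H¹(Eᵢ) = 0` for the twist by `a`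
or `b` and `H⁰(Eᵢ) = 0` for one less. They differ only in whether the sum or the intersection of the
spaces of values is controlled. -/
theorem IsBundle.almostBalanced_of_twistVanishing (hE : E.IsBundle) (h : E.TwistVanishing) :
    E.AlmostBalanced := by
  obtain ⟨a, b, h⟩ := twistVanishing_iff.1 h
  have hT (c : ℤ) : (T c : ℂ[T;T⁻¹]) = T 1 * T (c - 1) := by rw [← T_add, add_sub_cancel]
  have h₁ : (E.branch .fst).H1Zero (unitT a) ∧ (E.branch .fst).H0Zero (unitT (a - 1)) := by
    rcases h with ⟨h1, -, h0⟩ | ⟨h0, -, h1⟩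
    · exact ⟨branch_H1Zero .fst rfl h1,
        hE.branch_H0Zero .fst (c := unitTT a (b - 1)) (hT a) h0⟩
    · exact ⟨branch_H1Zero .fst rfl h1,
        hE.branch_H0Zero .fst (c := unitTT a b) (hT a) h0⟩
  have h₂ : (E.branch .snd).H1Zero (unitT b) ∧ (E.branch .snd).H0Zero (unitT (b - 1)) := by
    rcases h with ⟨h1, h0, -⟩ | ⟨h0, h1, -⟩
    · exact ⟨branch_H1Zero .snd rfl h1,
        hE.branch_H0Zero .snd (c := unitTT (a - 1) b) (hT b) h0⟩
    · exact ⟨branch_H1Zero .snd rfl h1,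
        hE.branch_H0Zero .snd (c := unitTT a b) (hT b) h0⟩
  obtain ⟨κ₁, _, d₁, e₁, hd₁, he₁⟩ := (hE.branch .fst).exists_frame h₁.1 h₁.2
  obtain ⟨κ₂, _, d₂, e₂, hd₂, he₂⟩ := (hE.branch .snd).exists_frame h₂.1 h₂.2
  refine hE.almostBalanced e₁ hd₁ e₂ hd₂ rfl rfl ?_
  rw [he₁, he₂]
  rcases h with h | h
  · exact .inl (sup_sectionValues_eq_top h.1)
  · exact .inr (hE.inf_sectionValues_eq_bot h.1)

end AngleModule

/-! ### General position implies almost balanced -/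

/-- If the truncated difference is a true one, the dimension formula gives the sum full dimension;
otherwise it is zero and so is the intersection. -/
theorem sup_eq_top_or_inf_eq_bot_of_finrank {K V : Type} [Field K] [AddCommGroup V] [Module K V]
    [FiniteDimensional K V] {P Q : Submodule K V} (h : Module.finrank K ↥(P ⊓ Q) =
      Module.finrank K P + Module.finrank K Q - Module.finrank K V) : P ⊔ Q = ⊤ ∨ P ⊓ Q = ⊥ := by
  have h' := Submodule.finrank_sup_add_finrank_inf_eq P Q
  by_cases hle : Module.finrank K V ≤ Module.finrank K P + Module.finrank K Q
  · exact .inl (Submodule.eq_top_of_finrank_eq (by lia))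
  · exact .inr ((Submodule.finrank_eq_zero (R := K)).1 (by lia))

namespace LineModule

variable {F : LineModule}

theorem range_fibre_comp_inl {G H : LineModule} {ι κ : Type} {c : ι → ℂ[T;T⁻¹]ˣ} {d : κ → ℂ[T;T⁻¹]ˣ}
    (f : G.Frame c) (g : H.Frame d) (h : ChartModule.Hom (G.sum H) F) (hh : h.IsIso) :
    LinearMap.range ((h.comp (ChartModule.inl G H)).fibre lineEv) =
      Submodule.span ℂ (fibreBasis ((f.sum g).map h hh) '' Set.range Sum.inl) := by
  rw [LinearMap.range_eq_map, ← (fibreBasis f).span_eq, Submodule.map_span, ← Set.range_comp,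
    ← Set.range_comp]
  congr 2
  funext i
  rw [Function.comp_apply, Function.comp_apply, fibreBasis_apply, fibreBasis_apply]
  refine (BaseChange.map_mk _ _ _ _ _ _).trans ?_
  change F.toFibre (h.onU (f.U i, 0)) = F.toFibre (h.onU (f.U.prod g.U (.inl i)))
  congr 2
  exact Prod.ext (by simp) (by simp)

theorem IsPositiveSubspace.almostBalanced {P : Submodule ℂ (F.fibre lineEv)}
    (h : F.IsPositiveSubspace P) : F.AlmostBalanced := by
  obtain ⟨k, r, s, -, h, hh, -⟩ := h
  exact ⟨k, r, s, h, hh⟩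

theorem IsPositiveSubspace.exists_frame {P : Submodule ℂ (F.fibre lineEv)}
    (h : F.IsPositiveSubspace P) : ∃ (κ : Type) (_ : Fintype κ) (k : ℤ) (d : κ → ℤ)
      (e : F.Frame fun i => unitT (d i)), (∀ i, d i = k ∨ d i = k - 1) ∧
      P = Submodule.span ℂ (fibreBasis e '' {i | d i = k}) := by
  obtain ⟨k, r, s, -, h, hh, rfl⟩ := h
  let f := ((ChartModule.Frame.copies (unitT k) r).sum
    (ChartModule.Frame.copies (unitT (k - 1)) s)).map h hh
  let d : Fin r ⊕ Fin s → ℤ := Sum.elim (fun _ => k) fun _ => k - 1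
  refine ⟨Fin r ⊕ Fin s, inferInstance, k, d,
    f.reindex (Equiv.refl _) (by rintro (i | i) <;> rfl), by rintro (i | i) <;> simp [d], ?_⟩
  refine (range_fibre_comp_inl (ChartModule.Frame.copies (unitT k) r)
    (ChartModule.Frame.copies (unitT (k - 1)) s) h hh).trans ?_
  have h1 : {i | d i = k} = Set.range Sum.inl := by
    ext (i | i) <;> simp [d]
  rw [h1]
  refine congrArg (Submodule.span ℂ) (Set.image_congr fun i _ => ?_)
  rw [fibreBasis_apply, fibreBasis_apply]
  exact congrArg F.toFibre (f.reindex_U (Equiv.refl _) _ i).symm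

/-- The indices are sorted by degree to reach the standard form. The hypothesis `hk` is the
normalization that the top degree occurs unless the bundle is zero, without which the subspace would
not be the positive one. -/
theorem isPositiveSubspace_of_frame {ι : Type} [Finite ι] {d : ι → ℤ} {k : ℤ}
    (e : F.Frame fun i => unitT (d i)) (hd : ∀ i, d i = k ∨ d i = k - 1)
    (hk : (∀ i, d i ≠ k) → IsEmpty ι) :
    F.IsPositiveSubspace (Submodule.span ℂ (fibreBasis e '' {i | d i = k})) := by
  classical
  let σ : ι ≃ Fin (Nat.card {i // d i = k}) ⊕ Fin (Nat.card {i // ¬ d i = k}) :=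
    (Equiv.sumCompl fun i => d i = k).symm.trans
      (Equiv.sumCongr (Finite.equivFin _) (Finite.equivFin _))
  have hσ₁ (i : ι) (hi : d i = k) : ∃ j, σ i = .inl j :=
    ⟨Finite.equivFin _ ⟨i, hi⟩, by
      rw [Equiv.trans_apply, Equiv.sumCompl_symm_apply_of_pos (p := fun i => d i = k) hi]
      rfl⟩
  have hσ₂ (i : ι) (hi : ¬ d i = k) : ∃ j, σ i = .inr j :=
    ⟨Finite.equivFin _ ⟨i, hi⟩, by
      rw [Equiv.trans_apply, Equiv.sumCompl_symm_apply_of_neg (p := fun i => d i = k) hi]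
      rfl⟩
  let f := e.reindex (d := Sum.elim (fun _ => unitT k) fun _ => unitT (k - 1)) σ (fun i => by
    by_cases hi : d i = k
    · obtain ⟨j, hj⟩ := hσ₁ i hi
      rw [hj, hi]
      rfl
    · obtain ⟨j, hj⟩ := hσ₂ i hi
      rw [hj, (hd i).resolve_left hi]
      rfl)
  let g₁ := ChartModule.Frame.copies (rA := lineResU) (rB := lineResV) (unitT k)
    (Nat.card {i // d i = k})
  let g₂ := ChartModule.Frame.copies (rA := lineResU) (rB := lineResV) (unitT (k - 1))
    (Nat.card {i // ¬ d i = k})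
  let g := g₁.sum g₂
  refine ⟨k, _, _, fun h => ?_, g.hom f, g.hom_isIso f, ?_⟩
  · have h1 := hk fun i hi => by
      have := Finite.card_eq_zero_iff.1 h
      exact this.false ⟨i, hi⟩
    exact Finite.card_eq_zero_iff.2 inferInstance
  · refine Eq.trans ?_ (range_fibre_comp_inl g₁ g₂ (g.hom f) (g.hom_isIso f)).symm
    congr 1
    have h1 (i : ι) : fibreBasis (g.map (g.hom f) (g.hom_isIso f)) (σ i) = fibreBasis e i := by
      rw [fibreBasis_apply, fibreBasis_apply, ChartModule.Frame.map_U, g.hom_onU]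
      exact congrArg F.toFibre (e.reindex_U σ _ i)
    have h2 : Set.range Sum.inl = σ '' {i | d i = k} := by
      ext j
      constructor
      · rintro ⟨j, rfl⟩
        refine ⟨σ.symm (.inl j), ?_, σ.apply_symm_apply _⟩
        by_contra hi
        obtain ⟨j', hj'⟩ := hσ₂ _ hi
        rw [σ.apply_symm_apply] at hj'
        cases hj'
      · rintro ⟨i, hi, rfl⟩
        obtain ⟨j, hj⟩ := hσ₁ i hi
        exact ⟨j, hj.symm⟩
    rw [h2, ← Set.image_comp]
    exact Set.image_congr fun i _ => (h1 i).symm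

end LineModule

namespace AngleModule

variable {E : AngleModule}

theorem IsBundle.almostBalanced_of_positiveGeneralPosition (hE : E.IsBundle)
    (h : E.PositiveGeneralPosition) : E.AlmostBalanced := by
  obtain ⟨-, -, P₁, P₂, h₁, h₂, h⟩ := h
  obtain ⟨κ₁, _, k, d₁, e₁, hd₁, rfl⟩ := h₁.exists_frame
  obtain ⟨κ₂, _, l, d₂, e₂, hd₂, rfl⟩ := h₂.exists_frame
  have hfin : FiniteDimensional ℂ (E.fibre nodeEv) :=
    Module.Finite.of_basis ((LineModule.fibreBasis e₁).map
      (LinearEquiv.ofBijective _ (hE.toBranchFibre_bijective .fst)).symm)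
  exact hE.almostBalanced e₁ hd₁ e₂ hd₂ rfl rfl (sup_eq_top_or_inf_eq_bot_of_finrank h)

end AngleModule

/-! ### Almost balanced implies general position -/

theorem span_image_inf_span_image {ι K V : Type} [Field K] [AddCommGroup V] [Module K V]
    (v : Module.Basis ι K V) (J₁ J₂ : Set ι) :
    Submodule.span K (v '' J₁) ⊓ Submodule.span K (v '' J₂) =
      Submodule.span K (v '' (J₁ ∩ J₂)) := by
  ext x
  rw [Submodule.mem_inf, v.mem_span_image, v.mem_span_image, v.mem_span_image, Set.subset_inter_iff]

theorem finrank_span_image {ι K V : Type} [Finite ι] [Field K] [AddCommGroup V] [Module K V]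
    (v : Module.Basis ι K V) (J : Set ι) :
    Module.finrank K (Submodule.span K (v '' J)) = J.ncard := by
  have := Fintype.ofFinite J
  have h := finrank_span_eq_card (v.linearIndependent.comp ((↑) : J → ι) Subtype.val_injective)
  rw [Set.range_comp, Subtype.range_coe] at h
  rw [h, Set.ncard_eq_toFinset_card', Set.toFinset_card]

/-- For subspaces spanned by parts of one basis, dimensions are cardinalities and the claim is
inclusion–exclusion; in the disjoint case the subtraction truncates to zero. -/
theorem finrank_inf_span_image {ι K V : Type} [Finite ι] [Field K] [AddCommGroup V] [Module K V]
    (v : Module.Basis ι K V) {J₁ J₂ : Set ι} (h : J₁ ∪ J₂ = Set.univ ∨ J₁ ∩ J₂ = ∅) :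
    Module.finrank K ↥(Submodule.span K (v '' J₁) ⊓ Submodule.span K (v '' J₂)) =
      Module.finrank K (Submodule.span K (v '' J₁)) +
        Module.finrank K (Submodule.span K (v '' J₂)) - Module.finrank K V := by
  rw [span_image_inf_span_image, finrank_span_image, finrank_span_image, finrank_span_image,
    Module.finrank_eq_nat_card_basis v, ← Set.ncard_univ]
  have h1 := Set.ncard_union_add_ncard_inter J₁ J₂
  have h2 := Set.ncard_le_ncard (Set.subset_univ (J₁ ∪ J₂))
  rcases h with h | h
  · rw [h] at h1
    lia
  · rw [h, Set.ncard_empty] at h1 ⊢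
    lia

/-- The subspace that the top degree part of a frame spans is positive, unless this part is zero; in
the latter case all of the fibre is. -/
theorem LineModule.exists_isPositiveSubspace {F : LineModule} {ι : Type} [Finite ι] {d : ι → ℤ}
    {k : ℤ} (e : F.Frame fun i => unitT (d i)) (hd : ∀ i, d i = k ∨ d i = k - 1) :
    ∃ J : Set ι, (J = {i | d i = k} ∨ J = Set.univ) ∧
      F.IsPositiveSubspace (Submodule.span ℂ (fibreBasis e '' J)) := by
  by_cases h : ∃ i, d i = k
  · obtain ⟨i, hi⟩ := h
    exact ⟨_, .inl rfl, isPositiveSubspace_of_frame e hd fun h => absurd hi (h i)⟩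
  · have hd' (i : ι) : d i = k - 1 := (hd i).resolve_left fun hi => h ⟨i, hi⟩
    have hJ : {i | d i = k - 1} = Set.univ := Set.eq_univ_of_forall hd'
    refine ⟨_, .inr rfl, hJ ▸ isPositiveSubspace_of_frame (k := k - 1) e (fun i => .inl (hd' i)) ?_⟩
    exact fun h => ⟨fun i => h i (hd' i)⟩

namespace AngleModule

variable {E : AngleModule}

/-- Both shapes have bidegrees in `{k, k-1} × {l, l-1}`; the first omits `(k-1, l-1)`, and the
second, after raising `k` and `l` by one, omits `(k, l)`. -/
theorem AlmostBalanced.exists_frame (h : E.AlmostBalanced) :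
    ∃ (ι : Type) (_ : Fintype ι) (a b : ι → ℤ) (k l : ℤ),
      Nonempty (E.Frame fun i => unitTT (a i) (b i)) ∧
      (∀ i, a i = k ∨ a i = k - 1) ∧ (∀ i, b i = l ∨ b i = l - 1) ∧
      ((∀ i, a i = k ∨ b i = l) ∨ ∀ i, ¬ (a i = k ∧ b i = l)) := by
  rcases h with ⟨k, l, r, s₁, s₂, h, hh⟩ | ⟨k, l, r₁, r₂, s, h, hh⟩
  · refine ⟨(Fin r ⊕ Fin s₁) ⊕ Fin s₂, inferInstance,
      Sum.elim (Sum.elim (fun _ => k) fun _ => k) fun _ => k - 1,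
      Sum.elim (Sum.elim (fun _ => l) fun _ => l - 1) fun _ => l, k, l,
      ⟨((sumFrame k l k (l - 1) (k - 1) l r s₁ s₂).map h hh).reindex (Equiv.refl _) ?_⟩, ?_, ?_,
      .inl ?_⟩
    all_goals rintro ((i | i) | i) <;> simp
  · refine ⟨(Fin r₁ ⊕ Fin r₂) ⊕ Fin s, inferInstance,
      Sum.elim (Sum.elim (fun _ => k + 1) fun _ => k) fun _ => k,
      Sum.elim (Sum.elim (fun _ => l) fun _ => l + 1) fun _ => l, k + 1, l + 1,
      ⟨((sumFrame (k + 1) l k (l + 1) k l r₁ r₂ s).map h hh).reindex (Equiv.refl _) ?_⟩, ?_, ?_,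
      .inr ?_⟩
    all_goals rintro ((i | i) | i) <;> simp

/-- The basis of the fibre at the node that a frame induces. -/
def fibreBasis {ι : Type} {c : ι → (ℂ[T;T⁻¹] × ℂ[T;T⁻¹])ˣ} (e : E.Frame c) :
    Module.Basis ι ℂ (E.fibre nodeEv) :=
  BaseChange.basis nodeEv e.U

theorem fibreBasis_apply {ι : Type} {c : ι → (ℂ[T;T⁻¹] × ℂ[T;T⁻¹])ˣ} (e : E.Frame c) (i : ι) :
    fibreBasis e i = E.toFibre (e.U i) :=
  BaseChange.basis_apply _ _ _

/-- The restriction of a frame to a branch. -/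
def branchFrame {ι : Type} {c : ι → (ℂ[T;T⁻¹] × ℂ[T;T⁻¹])ˣ} (e : E.Frame c) (s : Branch) :
    (E.branch s).Frame fun i => Units.map s.ρ.toMonoidHom (c i) :=
  e.pullback lineResU lineResV s.α s.β s.ρ s.hα s.hβ

theorem branchFrame_U {ι : Type} {c : ι → (ℂ[T;T⁻¹] × ℂ[T;T⁻¹])ˣ} (e : E.Frame c) (s : Branch)
    (i : ι) : (branchFrame e s).U i = E.toU s (e.U i) :=
  BaseChange.basis_apply _ _ _

theorem IsBundle.comap_span_branchFrame (hE : E.IsBundle) {ι : Type}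
    {c : ι → (ℂ[T;T⁻¹] × ℂ[T;T⁻¹])ˣ} (e : E.Frame c) (s : Branch) (J : Set ι) :
    (Submodule.span ℂ (LineModule.fibreBasis (branchFrame e s) '' J)).comap (E.toBranchFibre s) =
      Submodule.span ℂ (fibreBasis e '' J) := by
  have h : LineModule.fibreBasis (branchFrame e s) '' J =
      E.toBranchFibre s '' (fibreBasis e '' J) := by
    rw [← Set.image_comp]
    refine Set.image_congr fun i _ => ?_
    rw [Function.comp_apply, fibreBasis_apply, toBranchFibre_toFibre, LineModule.fibreBasis_apply,
      branchFrame_U]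
  rw [h, Submodule.span_image,
    Submodule.comap_map_eq_of_injective (hE.toBranchFibre_bijective s).1]

theorem IsBundle.positiveGeneralPosition_of_almostBalanced (hE : E.IsBundle)
    (h : E.AlmostBalanced) : E.PositiveGeneralPosition := by
  obtain ⟨ι, _, a, b, k, l, ⟨e⟩, ha, hb, hab⟩ := h.exists_frame
  obtain ⟨J₁, hJ₁, h₁⟩ := LineModule.exists_isPositiveSubspace (d := a) (branchFrame e .fst) ha
  obtain ⟨J₂, hJ₂, h₂⟩ := LineModule.exists_isPositiveSubspace (d := b) (branchFrame e .snd) hb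
  -- If the top degree is absent on one branch, the positive subspace there is the whole fibre, and
  -- the position is general whatever the other one is.
  have hJ : J₁ ∪ J₂ = Set.univ ∨ J₁ ∩ J₂ = ∅ := by
    rcases hJ₁ with rfl | rfl
    · rcases hJ₂ with rfl | rfl
      · rcases hab with hab | hab
        · exact .inl (Set.eq_univ_of_forall hab)
        · exact .inr (Set.eq_empty_of_forall_notMem hab)
      · exact .inl (Set.union_univ _)
    · exact .inl (Set.univ_union _)
  refine ⟨h₁.almostBalanced, h₂.almostBalanced, _, _, h₁, h₂, ?_⟩
  have key := finrank_inf_span_image (fibreBasis e) hJ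
  rw [← hE.comap_span_branchFrame e .fst J₁, ← hE.comap_span_branchFrame e .snd J₂] at key
  exact key

end AngleModule

/-! ### Cohomology of line bundles, and almost balanced implies vanishing -/

/-- The monomials `x ^ n` with `n ≥ 0` come from `U` and those with `n ≤ α` from `V`; for `α ≥ -1`
no exponent is left out. -/
theorem exists_eq_lineResU_add {α : ℤ} (hα : -1 ≤ α) (r : ℂ[T;T⁻¹]) :
    ∃ p q, r = lineResU p + T α * lineResV q := by
  induction r using LaurentPolynomial.induction_on' with
  | add r r' h h' =>
    obtain ⟨p, q, rfl⟩ := h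
    obtain ⟨p', q', rfl⟩ := h'
    exact ⟨p + p', q + q', by rw [map_add, map_add]; ring⟩
  | C_mul_T n c =>
    by_cases hn : 0 ≤ n
    · refine ⟨Polynomial.C c * X ^ n.toNat, 0, ?_⟩
      rw [map_mul, lineResU_X_pow, map_zero, mul_zero, add_zero, Int.toNat_of_nonneg hn]
      simp [lineResU]
    · refine ⟨0, Polynomial.C c * X ^ (α - n).toNat, ?_⟩
      rw [map_mul, lineResV_X_pow, map_zero, zero_add, mul_left_comm, ← T_add,
        Int.toNat_of_nonneg (by lia), show α + -(α - n) = n by ring]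
      simp [lineResV]

/-- For `α ≥ 0` the constants come from both charts, so they can be moved between the two terms to
prescribe the value at `0`. -/
theorem exists_eq_lineResU_add_of_eval {α : ℤ} (hα : 0 ≤ α) (r : ℂ[T;T⁻¹]) (c : ℂ) :
    ∃ p q, r = lineResU p + T α * lineResV q ∧ p.eval 0 = c := by
  obtain ⟨p, q, rfl⟩ := exists_eq_lineResU_add (α := α) (by lia) r
  obtain ⟨x, rfl⟩ : ∃ x, c = p.eval 0 + x := ⟨c - p.eval 0, by ring⟩
  refine ⟨p + Polynomial.C x, q - Polynomial.C x * X ^ α.toNat, ?_, by simp⟩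
  rw [map_add, map_sub, map_mul, lineResV_X_pow, lineResV_C, Int.toNat_of_nonneg hα, mul_sub,
    mul_left_comm, ← T_add, add_neg_cancel, T_zero, mul_one]
  ring

theorem eq_zero_of_lineResU_eq {α : ℤ} (hα : α ≤ -1) {p q : ℂ[X]}
    (h : lineResU p = T α * lineResV q) : p = 0 ∧ q = 0 := by
  have h1 : lineResU q.reverse = lineResV q * T q.natDegree := toLaurent_reverse q
  -- After clearing denominators the right side has degree at most that of `q`, whereas for `p ≠ 0`
  -- the left side exceeds it, as `α < 0`.
  have h2 : X ^ (q.natDegree + (-α).toNat) * p = q.reverse := by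
    apply lineResU_injective
    rw [map_mul, lineResU_X_pow, h, h1, ← mul_assoc, ← T_add, mul_comm]
    congr 2
    push_cast
    lia
  have h3 : p = 0 := by
    by_contra hp
    have h4 := congrArg natDegree h2
    rw [natDegree_mul (pow_ne_zero _ X_ne_zero) hp, natDegree_X_pow] at h4
    have := reverse_natDegree_le q
    lia
  refine ⟨h3, ?_⟩
  rw [h3, mul_zero, eq_comm, reverse_eq_zero] at h2
  exact h2

theorem eq_zero_of_lineResU_eq_of_eval {α : ℤ} (hα : α ≤ 0) {p q : ℂ[X]}
    (h : lineResU p = T α * lineResV q) (hp : p.eval 0 = 0) : p = 0 ∧ q = 0 := by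
  obtain ⟨f, rfl⟩ := X_dvd_iff.2 ((coeff_zero_eq_eval_zero p).trans hp)
  obtain ⟨h1, h2⟩ := eq_zero_of_lineResU_eq (α := α - 1) (p := f) (q := q) (by lia) (by
    rw [map_mul, lineResU_X] at h
    have := congrArg (fun z => T (-1) * z) h
    simpa only [← mul_assoc, ← T_add, neg_add_cancel, T_zero, one_mul, neg_add_eq_sub] using this)
  exact ⟨by rw [h1, mul_zero], h2⟩

/-- The component of degree at least `-1` is solved first; the other one, of degree at least `0`,
can then be solved with the value at the node that this dictates. -/
theorem exists_eq_angleResU_add {α β : ℤ} (h : 0 ≤ α ∧ -1 ≤ β ∨ -1 ≤ α ∧ 0 ≤ β)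
    (r : ℂ[T;T⁻¹] × ℂ[T;T⁻¹]) :
    ∃ a b, r = angleResU a + (unitTT α β : ℂ[T;T⁻¹] × ℂ[T;T⁻¹]) * angleResV b := by
  rcases h with ⟨hα, hβ⟩ | ⟨hα, hβ⟩
  · obtain ⟨p₂, q₂, h₂⟩ := exists_eq_lineResU_add hβ r.2
    obtain ⟨p₁, q₁, h₁, hp⟩ := exists_eq_lineResU_add_of_eval hα r.1 (p₂.eval 0)
    exact ⟨⟨(p₁, p₂), hp⟩, (q₁, q₂), Prod.ext h₁ h₂⟩
  · obtain ⟨p₁, q₁, h₁⟩ := exists_eq_lineResU_add hα r.1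
    obtain ⟨p₂, q₂, h₂, hp⟩ := exists_eq_lineResU_add_of_eval hβ r.2 (p₁.eval 0)
    exact ⟨⟨(p₁, p₂), hp.symm⟩, (q₁, q₂), Prod.ext h₁ h₂⟩

/-- A section vanishes on the branch of negative degree, hence at the node, and a section of
nonpositive degree that vanishes at a point is zero. -/
theorem eq_zero_of_angleResU_eq {α β : ℤ} (h : α ≤ -1 ∧ β ≤ 0 ∨ α ≤ 0 ∧ β ≤ -1)
    {a : nodeRing} {b : ℂ[X] × ℂ[X]}
    (hab : angleResU a = (unitTT α β : ℂ[T;T⁻¹] × ℂ[T;T⁻¹]) * angleResV b) : a = 0 ∧ b = 0 := by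
  have h₁ : lineResU a.1.1 = T α * lineResV b.1 := congrArg Prod.fst hab
  have h₂ : lineResU a.1.2 = T β * lineResV b.2 := congrArg Prod.snd hab
  rcases h with ⟨hα, hβ⟩ | ⟨hα, hβ⟩
  · obtain ⟨h3, h4⟩ := eq_zero_of_lineResU_eq hα h₁
    obtain ⟨h5, h6⟩ := eq_zero_of_lineResU_eq_of_eval hβ h₂ (by
      rw [← nodeRing_eval_eq, h3, eval_zero])
    exact ⟨nodeRing_ext h3 h5, Prod.ext h4 h6⟩
  · obtain ⟨h5, h6⟩ := eq_zero_of_lineResU_eq hβ h₂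
    obtain ⟨h3, h4⟩ := eq_zero_of_lineResU_eq_of_eval hα h₁ (by
      rw [nodeRing_eval_eq, h5, eval_zero])
    exact ⟨nodeRing_ext h3 h5, Prod.ext h4 h6⟩

namespace AngleModule

variable {E : AngleModule} {ι : Type} [Fintype ι] {a b : ι → ℤ}

theorem H1Zero_of_frame (e : E.Frame fun i => unitTT (a i) (b i)) (c d : ℤ)
    (h : ∀ i, 0 ≤ c + a i ∧ -1 ≤ d + b i ∨ -1 ≤ c + a i ∧ 0 ≤ d + b i) :
    E.H1Zero (unitTT c d) :=
  e.H1Zero _ fun i r => by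
    simpa only [← mul_assoc, ← Units.val_mul, unitTT_mul] using exists_eq_angleResU_add (h i) r

theorem H0Zero_of_frame (e : E.Frame fun i => unitTT (a i) (b i)) (c d : ℤ)
    (h : ∀ i, c + a i ≤ -1 ∧ d + b i ≤ 0 ∨ c + a i ≤ 0 ∧ d + b i ≤ -1) :
    E.H0Zero (unitTT c d) :=
  e.H0Zero _ fun i p q hpq => by
    rw [← mul_assoc, ← Units.val_mul, unitTT_mul] at hpq
    exact eq_zero_of_angleResU_eq (h i) hpq

/-- After the twist by `(-k, -l)` all bidegrees lie in `{0, -1} × {0, -1}`. The first shape omits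
`(-1, -1)`, the only one of them with `H¹ ≠ 0`, and the second omits `(0, 0)`, the only one with `H⁰
≠ 0`. The further twists by one lower or raise a single degree, which leaves no sections or no `H¹`,
respectively. -/
theorem AlmostBalanced.twistVanishing (h : E.AlmostBalanced) : E.TwistVanishing := by
  obtain ⟨ι, _, a, b, k, l, ⟨e⟩, ha, hb, hab⟩ := h.exists_frame
  rw [twistVanishing_iff]
  refine ⟨-k, -l, ?_⟩
  rcases hab with hab | hab
  · refine .inl ⟨H1Zero_of_frame e _ _ fun i => ?_, H0Zero_of_frame e _ _ fun i => ?_,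
      H0Zero_of_frame e _ _ fun i => ?_⟩ <;>
    · have := ha i
      have := hb i
      have := hab i
      lia
  · refine .inr ⟨H0Zero_of_frame e _ _ fun i => ?_, H1Zero_of_frame e _ _ fun i => ?_,
      H1Zero_of_frame e _ _ fun i => ?_⟩ <;>
    · have := ha i
      have := hb i
      have := hab i
      lia

end AngleModule

end RatAngle

end

theorem proposition5p3 {C : AlgebraicGeometry.Scheme.{0}} (S : RatAngle.RationalAngle C)
    (E : C.Modules) (hE : RatAngle.IsVectorBundle E) :
    List.TFAE
      [(S.sections E).AlmostBalanced,
       (S.sections E).PositiveGeneralPosition,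
       (S.sections E).TwistVanishing] := by
  have hS := S.isBundle_sections hE
  tfae_have 1 → 2 := hS.positiveGeneralPosition_of_almostBalanced
  tfae_have 2 → 1 := hS.almostBalanced_of_positiveGeneralPosition
  tfae_have 1 → 3 := fun h => h.twistVanishing
  tfae_have 3 → 1 := hS.almostBalanced_of_twistVanishing
  tfae_finish
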